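/- Let $p$ be a prime and $G_0$ a finite group whose order is divisible by $p$. Let $P_0$ be a $p$-Sylow subgroup of $G_0$ and $G_0'=N_{G_0}(P_0)$. For a finite group $G$, a universal $p$-Frattini cover $\phi:{}_p\tilde G\to G$ is a continuous epimorphism from a profinite group that is $p$-projective (every finite embedding problem with $p$-group kernel is weakly solvable), such that $\ker\phi$ is pro-$p$ and no proper closed subgroup of ${}_p\tilde G$ maps onto $G$; it is unique up to isomorphism over $G$. Put $\ker_0=\ker\phi$, let $\ker_1$ be the closed subgroup generated by the $p$-th powers and commutators of elements of $\ker_0$ (the Frattini subgroup of $\ker_0$), and let $G_1={}_p\tilde G/\ker_1$. The first characteristic $p$-Frattini module of $G$ is $\ker_0/\ker_1=\ker(G_1\to G)$, an $\mathbb F_p[G]$-module under conjugation. Write $M_0,\ G_1\to G_0$ for these objects for $G_0$, and $M_0',\ G_1'\to G_0'$ for those for $G_0'$. Regard $\phi_{1,0}^{-1}(G_0')\subseteq G_1$ as an extension of $G_0'$ by $M_0$, where $\phi_{1,0}:G_1\to G_0$. Let $\alpha'\in H^2(G_0',M_0')$ be the class of $1\to M_0'\to G_1'\to G_0'\to 1$,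 let $\alpha\in H^2(G_0,\mathrm{Ind}_{G_0'}^{G_0}(M_0'))$ correspond to $\alpha'$ under Shapiro's isomorphism (restriction to $G_0'$ followed by the projection $\mathrm{Ind}_{G_0'}^{G_0}(M_0')\to M_0'$), and let $$1\to \mathrm{Ind}_{G_0'}^{G_0}(M_0')\to G^*\to G_0\to 1$$ be an extension with class $\alpha$. Then: 1. There is a homomorphism $\gamma:G_1'\to \phi_{1,0}^{-1}(G_0')$ over $G_0'$. 2. For every such $\gamma$, let $\psi:\mathrm{Ind}_{G_0'}^{G_0}(M_0')\to M_0$ be the $\mathbb F_p[G_0]$-homomorphism that extends $\gamma|_{M_0'}:M_0'\to M_0$. Then $\psi$ is surjective. With $N=\ker\psi$ there is an $\mathbb F_p[G_0]$-submodule $M$ with $\mathrm{Ind}_{G_0'}^{G_0}(M_0')=M\oplus N$ and $M\cong M_0$. The subgroup $N$ is normal in $G^*$, and there is an isomorphism $G^*/N\to G_1$ of covers of $G_0$ whose restriction to $\mathrm{Ind}_{G_0'}^{G_0}(M_0')/N$ is the map induced by $\psi$ multiplied by a nonzero scalar of $\mathbb F_p$. 3. The $\mathbb F_p[G_0]$-module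 $M_0$ is indecomposable; thus it is an indecomposable direct summand of $\mathrm{Ind}_{G_0'}^{G_0}(M_0')$. 4. If $\mathrm{Ind}_{G_0'}^{G_0}(M_0')$ is an indecomposable $\mathbb F_p[G_0]$-module, then $G^*$ and $G_1$ are isomorphic as covers of $G_0$. -/

import Mathlib

open CategoryTheory

noncomputable section

namespace PFrattini

/-! ### Shapiro's isomorphism in degree two -/

section Shapiro

open groupCohomology

variable {k G : Type} [CommRing k] [Group G] (H : Subgroup G) (A : Rep.{0} k H)

/-- Evaluation at `1`, an `H`-map `CoInd_H^G A → A`. -/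
def evalOne : Rep.res H.subtype (Rep.coind H.subtype A) ⟶ A :=
  (Rep.resCoindHomEquiv.{0} H.subtype (Rep.coind H.subtype A) A).symm (𝟙 _)

lemma evalOne_apply (f : Rep.coind H.subtype A) : (evalOne H A).hom f = f.1 1 := rfl

lemma coind_rho_apply (g x : G) (f : Rep.coind H.subtype A) :
    ((Rep.coind H.subtype A).ρ g f).1 x = f.1 (x * g) := rfl

/-- The map `H²(G, CoInd_H^G A) → H²(H, A)`: restrict to `H`, then evaluate at `1`. -/
def coindShapiro : H2 (Rep.coind H.subtype A) ⟶ H2 A :=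
  groupCohomology.map H.subtype (evalOne H A) 2

lemma coindShapiro_H2π (c : cocycles₂ (Rep.coind H.subtype A)) (a : cocycles₂ A)
    (h : ∀ x y : H, (c (x.1, y.1)).1 1 = a (x, y)) :
    coindShapiro H A (H2π _ c) = H2π _ a := by
  refine (H2π_comp_map_apply H.subtype (evalOne H A) c).trans ?_
  congr 1
  apply cocycles₂_ext
  intro x y
  exact h x y

lemma exists_retraction : ∃ r : G → H, (∀ (h : H) (g : G), r (h * g) = h * r g) ∧
    ∀ h : H, r h = h := by
  obtain ⟨T, hT, h1⟩ := H.exists_isComplement_right 1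
  refine ⟨fun g => (hT.equiv g).1, fun h g => ?_, fun h => ?_⟩
  · exact congrArg Prod.fst (hT.equiv_mul_left h g)
  · have := hT.equiv_mul_left h 1
    simp only [mul_one] at this
    simp only [this]
    rw [hT.equiv_one H.one_mem h1]
    simp

theorem coindShapiro_surjective : Function.Surjective (coindShapiro H A) := by
  intro a
  induction a using H2_induction_on with | h a =>
  obtain ⟨r, hr, hr1⟩ := exists_retraction H
  have ha := (mem_cocycles₂_iff (a : H × H → A)).1 a.2
  let F : G → G → G → A := fun x y z => A.ρ (r x) (a ((r x)⁻¹ * r y, (r y)⁻¹ * r z))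
  have hF : ∀ (h : H) x y z, F (h * x) (h * y) (h * z) = A.ρ h (F x y z) := by
    intro h x y z
    simp only [F, hr, map_mul, Module.End.mul_apply]
    congr 4 <;> group
  have hd : ∀ x y z w, F x z w + F x y z = F y z w + F x y w := by
    intro x y z w
    have h1 := ha ((r x)⁻¹ * r y) ((r y)⁻¹ * r z) ((r z)⁻¹ * r w)
    have h2 := congrArg (A.ρ (r x)) h1
    simp only [map_add, ← Module.End.mul_apply, ← map_mul] at h2
    simp only [F]
    convert h2 using 4 <;> group
  let c : G × G → Rep.coind H.subtype A := fun g =>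
    ⟨fun x => F x (x * g.1) (x * g.1 * g.2), fun h x => by
      have := hF h x (x * g.1) (x * g.1 * g.2)
      simpa [mul_assoc] using this⟩
  have hc : c ∈ cocycles₂ (Rep.coind H.subtype A) := by
    rw [mem_cocycles₂_iff]
    intro g h j
    apply Subtype.ext
    funext x
    have := hd x (x * g) (x * g * h) (x * g * h * j)
    change F x (x * (g * h)) (x * (g * h) * j) + F x (x * g) (x * g * h) =
      F (x * g) (x * g * h) (x * g * h * j) + F x (x * g) (x * g * (h * j))
    simpa only [mul_assoc] using this
  refine ⟨H2π _ ⟨c, hc⟩, coindShapiro_H2π _ _ _ _ ?_⟩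
  intro x y
  change F 1 (1 * x) (1 * x * y) = _
  have e1 : r 1 = 1 := hr1 1
  have e2 : r ((x : G) * y) = x * y := hr1 (x * y)
  simp [F, hr1, e1, e2]

theorem coindShapiro_injective : Function.Injective (coindShapiro H A) := by
  rw [injective_iff_map_eq_zero]
  intro c
  induction c using H2_induction_on with | h c =>
  intro h0
  have hc := (mem_cocycles₂_iff (c : G × G → Rep.coind H.subtype A)).1 c.2
  have ha : (fun x : H × H => (c (x.1.1, x.2.1)).1 1) ∈ cocycles₂ A := by
    rw [mem_cocycles₂_iff]
    intro g h j
    have := congrFun (congrArg Subtype.val (hc g h j)) 1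
    have e := (c (h.1, j.1)).2 g 1
    have e' : (c (h.1, j.1)).1 (1 * g.1) = A.ρ g ((c (h.1, j.1)).1 1) := by
      rw [← e]; simp
    rw [← e']
    exact this
  rw [coindShapiro_H2π H A c ⟨_, ha⟩ (fun _ _ => rfl), H2π_eq_zero_iff] at h0
  obtain ⟨b, hb⟩ := h0
  obtain ⟨r, hr, hr1⟩ := exists_retraction H
  have hb' : ∀ x y : H, A.ρ x (b y) - b (x * y) + b x = (c (x.1, y.1)).1 1 := fun x y =>
    congrFun hb (x, y)
  -- homogeneous cochain attached to `c`
  let F : G → G → G → A := fun x y z => (c (x⁻¹ * y, y⁻¹ * z)).1 x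
  have hF : ∀ (h : H) x y z, F (h * x) (h * y) (h * z) = A.ρ h (F x y z) := by
    intro h x y z
    have := (c (x⁻¹ * y, y⁻¹ * z)).2 h x
    simp only [F]
    rw [← this]
    simp [mul_assoc]
  have hd : ∀ x y z w, F x z w + F x y z = F y z w + F x y w := by
    intro x y z w
    have := congrFun (congrArg Subtype.val (hc (x⁻¹ * y) (y⁻¹ * z) (z⁻¹ * w))) x
    change (c (x⁻¹ * y * (y⁻¹ * z), z⁻¹ * w)).1 x + (c (x⁻¹ * y, y⁻¹ * z)).1 x =
      (c (y⁻¹ * z, z⁻¹ * w)).1 (x * (x⁻¹ * y)) +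
        (c (x⁻¹ * y, y⁻¹ * z * (z⁻¹ * w))).1 x at this
    simpa [F, mul_assoc] using this
  let K : G → G → A := fun x y => F (r x) x y - F (r x) (r y) y
    + A.ρ (r x) (b ((r x)⁻¹ * r y))
  have hK : ∀ (h : H) x y, K (h * x) (h * y) = A.ρ h (K x y) := by
    intro h x y
    simp only [K, hr, map_mul, Module.End.mul_apply, map_add, map_sub, ← hF, Subgroup.coe_mul]
    congr 4
    group
  have hFr : ∀ x y z, F (r x) (r y) (r z) = A.ρ (r x) (b ((r x)⁻¹ * r y))
      + A.ρ (r y) (b ((r y)⁻¹ * r z)) - A.ρ (r x) (b ((r x)⁻¹ * r z)) := by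
    intro x y z
    have h1 := hF (r x) 1 ((r x)⁻¹ * r y : H) ((r x)⁻¹ * r z : H)
    have h2 := hb' ((r x)⁻¹ * r y) ((r y)⁻¹ * r z)
    have h3 := congrArg (A.ρ (r x)) h2
    simp only [map_add, map_sub, ← Module.End.mul_apply, ← map_mul] at h3
    have h4 : F 1 ((r x)⁻¹ * r y : H) ((r x)⁻¹ * r z : H) =
        (c (((r x)⁻¹ * r y : H).1, ((r y)⁻¹ * r z : H).1)).1 1 := by
      simp [F, mul_assoc]
    rw [← h4, ← h1] at h3
    simp only [← Subgroup.coe_mul, mul_assoc, mul_inv_cancel_left, mul_one] at h3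
    rw [← h3]
    abel
  have hdK : ∀ x y z, K y z - K x z + K x y = F x y z := by
    intro x y z
    have e1 := hd (r x) x y z
    have e2 := hd (r x) (r y) y z
    have e3 := hd (r x) (r y) (r z) z
    have e4 := hFr x y z
    simp only [K]
    grind
  rw [H2π_eq_zero_iff]
  refine ⟨fun g => ⟨fun x => K x (x * g), fun h x => ?_⟩, ?_⟩
  · have := hK h x (x * g)
    simpa [mul_assoc] using this
  · funext ⟨g, h⟩
    apply Subtype.ext
    funext x
    have := hdK x (x * g) (x * g * h)
    change K (x * g) (x * g * h) - K x (x * (g * h)) + K x (x * g) = (c (g, h)).1 x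
    simpa [F, mul_assoc] using this


/-- The `H`-map `Ind_H^G A → A` that projects onto the summand indexed by the trivial coset. -/
def indProj [H.FiniteIndex] : Rep.res H.subtype (Rep.ind H.subtype A) ⟶ A :=
  open scoped Classical in
  (Rep.resFunctor H.subtype).map (Rep.indCoindIso A).hom ≫ evalOne H A

/-- Shapiro's map `H²(G, Ind_H^G A) → H²(H, A)`: restrict to `H`, then apply the
projection `Ind_H^G A → A`. -/
def shapiro [H.FiniteIndex] : H2 (Rep.ind H.subtype A) ⟶ H2 A :=
  groupCohomology.map H.subtype (indProj H A) 2

/-- Shapiro's lemma: the map `H²(G, Ind_H^G A) → H²(H, A)` is bijective. -/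
theorem shapiro_bijective [H.FiniteIndex] : Function.Bijective (shapiro H A) := by
  classical
  let F := groupCohomology.functor k G 2
  have h : shapiro H A = F.map (Rep.indCoindIso A).hom ≫ coindShapiro H A :=
    (groupCohomology.map_comp (A := Rep.ind H.subtype A) (B := Rep.coind H.subtype A) (C := A)
      (MonoidHom.id G) H.subtype (Rep.indCoindIso A).hom (evalOne H A) 2)
  have hb : Function.Bijective (F.map (Rep.indCoindIso A).hom) :=
    ConcreteCategory.bijective_of_isIso _
  have hc : Function.Bijective (coindShapiro H A) :=
    ⟨coindShapiro_injective H A, coindShapiro_surjective H A⟩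
  rw [h]
  exact hc.comp hb

/-- The class in `H²(G, Ind_H^G A)` that corresponds to a class in `H²(H, A)` under Shapiro's
isomorphism. -/
def inducedClass [H.FiniteIndex] (a : H2 A) : H2 (Rep.ind H.subtype A) :=
  (Equiv.ofBijective _ (shapiro_bijective H A)).symm a

end Shapiro

/-! ### Group extensions and classes in `H²` -/

section Extensions

open groupCohomology

/-- The extension `S` of `G` by the underlying group of the representation `A` induces the
given action of `G` on `A` (by conjugation), and its class in `H²(G, A)` is `c`: some
set-theoretic section has a factor set that represents `c`. -/
structure HasClass {k G E : Type} [CommRing k] [Group G] [Group E] {A : Rep.{0} k G}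
    (S : GroupExtension (Multiplicative A) E G) (c : H2 A) : Prop where
  conj (e : E) (a : A) :
    S.inl (Multiplicative.ofAdd (A.ρ (S.rightHom e) a)) = e * S.inl (Multiplicative.ofAdd a) * e⁻¹
  exists_factorSet : ∃ (σ : S.Section) (x : cocycles₂ A),
    (∀ g h : G, σ g * σ h = S.inl (Multiplicative.ofAdd (x (g, h))) * σ (g * h)) ∧ H2π A x = c

/-- The subgroup of the extension `E` that corresponds to a subrepresentation `N` of `A`. -/
def subrepSubgroup {k G E : Type} [CommRing k] [Group G] [Group E] {A : Rep.{0} k G}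
    (S : GroupExtension (Multiplicative A) E G) (N : Subrepresentation A.ρ) : Subgroup E :=
  (AddSubgroup.toSubgroup N.toSubmodule.toAddSubgroup).map S.inl

/-- `f : E →* G` is surjective, with kernel an elementary abelian `p`-group. -/
structure IsElemAbCover (p : ℕ) {E G : Type} [Group E] [Group G] (f : E →* G) : Prop where
  surjective : Function.Surjective f
  comm : ∀ x ∈ f.ker, ∀ y ∈ f.ker, x * y = y * x
  pow_eq_one : ∀ x ∈ f.ker, x ^ p = 1

variable {p : ℕ} {E G : Type} [Group E] [Group G] {f : E →* G}

abbrev IsElemAbCover.addCommGroup (h : IsElemAbCover p f) : AddCommGroup (Additive f.ker) :=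
  { (inferInstance : AddGroup (Additive f.ker)) with
    add_comm := fun x y => congrArg Additive.ofMul
      (Subtype.ext (h.comm _ x.toMul.2 _ y.toMul.2) : x.toMul * y.toMul = y.toMul * x.toMul) }

abbrev IsElemAbCover.module (h : IsElemAbCover p f) :
    letI := h.addCommGroup
    Module (ZMod p) (Additive f.ker) :=
  letI := h.addCommGroup
  AddCommGroup.zmodModule fun x => congrArg Additive.ofMul
    (Subtype.ext (h.pow_eq_one _ x.toMul.2) : x.toMul ^ p = 1)

/-- Conjugation by `e` on the kernel of `f`, written additively. -/
def conjKer (f : E →* G) (e : E) : Additive f.ker →+ Additive f.ker :=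
  MonoidHom.toAdditive (MulAut.conjNormal e : f.ker ≃* f.ker).toMonoidHom

theorem coe_conjKer (e : E) (x : Additive f.ker) :
    ((conjKer f e x).toMul : E) = e * (x.toMul : E) * e⁻¹ := rfl

theorem IsElemAbCover.conjKer_eq (h : IsElemAbCover p f) {e e' : E} (he : f e = f e') :
    conjKer f e = conjKer f e' := by
  refine AddMonoidHom.ext fun x => Additive.toMul.injective (Subtype.ext ?_)
  rw [coe_conjKer, coe_conjKer]
  have hk : e'⁻¹ * e ∈ f.ker := by simp [MonoidHom.mem_ker, he]
  have := h.comm _ hk _ x.toMul.2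
  calc e * (x.toMul : E) * e⁻¹ = e' * ((e'⁻¹ * e) * (x.toMul : E)) * e⁻¹ := by group
    _ = e' * (x.toMul : E) * e'⁻¹ := by rw [this]; group

/-- The kernel of `f`, as an `𝔽_p[G]`-module: `g` acts by conjugation by any lift of `g` to `E`. -/
def IsElemAbCover.kerRep (h : IsElemAbCover p f) : Rep.{0} (ZMod p) G :=
  letI := h.addCommGroup
  letI := h.module
  Rep.of (X := Additive f.ker)
    { toFun := fun g => (conjKer f (Function.surjInv h.surjective g)).toZModLinearMap p
      map_one' := by
        refine LinearMap.ext fun x => ?_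
        change conjKer f _ x = x
        rw [h.conjKer_eq ((Function.surjInv_eq h.surjective 1).trans (map_one f).symm)]
        apply Additive.toMul.injective
        apply Subtype.ext
        rw [coe_conjKer]
        simp
      map_mul' := fun g g' => by
        refine LinearMap.ext fun x => ?_
        change conjKer f _ x = conjKer f _ (conjKer f _ x)
        rw [h.conjKer_eq (e' := Function.surjInv h.surjective g * Function.surjInv h.surjective g')
          (by simp only [map_mul, Function.surjInv_eq])]
        apply Additive.toMul.injective
        apply Subtype.ext
        simp only [coe_conjKer]
        group }

/-- The element of the kernel of `f` underlying an element of the module `h.kerRep`. -/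
def IsElemAbCover.incl (h : IsElemAbCover p f) : Multiplicative h.kerRep →* E where
  toFun x := ((show Additive f.ker from Multiplicative.toAdd x).toMul : f.ker)
  map_one' := rfl
  map_mul' _ _ := rfl

theorem IsElemAbCover.incl_mem (h : IsElemAbCover p f) (x : Multiplicative h.kerRep) :
    h.incl x ∈ f.ker :=
  (show Additive f.ker from Multiplicative.toAdd x).toMul.2

theorem IsElemAbCover.incl_injective (h : IsElemAbCover p f) : Function.Injective h.incl :=
  fun _ _ hxy => Subtype.ext hxy

theorem IsElemAbCover.incl_ofAdd_injective (h : IsElemAbCover p f) {x y : h.kerRep}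
    (hxy : h.incl (Multiplicative.ofAdd x) = h.incl (Multiplicative.ofAdd y)) : x = y :=
  Multiplicative.ofAdd.injective (h.incl_injective hxy)

/-- The element of `h.kerRep` given by an element of the kernel of `f`. -/
def IsElemAbCover.ofKer (h : IsElemAbCover p f) (e : E) (he : e ∈ f.ker) : h.kerRep :=
  (Additive.ofMul (⟨e, he⟩ : f.ker) : Additive f.ker)

theorem IsElemAbCover.incl_ofKer (h : IsElemAbCover p f) (e : E) (he : e ∈ f.ker) :
    h.incl (Multiplicative.ofAdd (h.ofKer e he)) = e := rfl

theorem IsElemAbCover.incl_smul (h : IsElemAbCover p f) (e : E) (x : h.kerRep) :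
    h.incl (Multiplicative.ofAdd (h.kerRep.ρ (f e) x)) =
      e * h.incl (Multiplicative.ofAdd x) * e⁻¹ := by
  change ((conjKer f (Function.surjInv h.surjective (f e)) x).toMul : E) = _
  rw [h.conjKer_eq (e' := e) (Function.surjInv_eq _ _)]
  rfl

/-- The extension `1 → ker f → E → G → 1`. -/
def IsElemAbCover.extension (h : IsElemAbCover p f) :
    GroupExtension (Multiplicative h.kerRep) E G where
  inl := h.incl
  rightHom := f
  inl_injective := h.incl_injective
  range_inl_eq_ker_rightHom := by
    ext e
    exact ⟨fun ⟨x, hx⟩ => hx ▸ h.incl_mem x, fun he => ⟨Additive.ofMul (⟨e, he⟩ : f.ker), rfl⟩⟩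
  rightHom_surjective := h.surjective

end Extensions

/-! ### Universal `p`-Frattini covers -/

section Frattini

/-- The closed subgroup generated by the `p`-th powers and the commutators of elements of `N`.
This is the Frattini subgroup of `N` if `N` is a pro-`p` group. -/
def frattiniPro (p : ℕ) {Γ : Type} [Group Γ] [TopologicalSpace Γ] [IsTopologicalGroup Γ]
    (N : Subgroup Γ) : Subgroup Γ :=
  (Subgroup.closure ((fun x => x ^ p) '' (N : Set Γ)) ⊔ ⁅N, N⁆).topologicalClosure

instance (p : ℕ) {Γ : Type} [Group Γ] [TopologicalSpace Γ] [IsTopologicalGroup Γ]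
    (N : Subgroup Γ) [N.Normal] : (frattiniPro p N).Normal := by
  have : (Subgroup.closure ((fun x => x ^ p) '' (N : Set Γ))).Normal := by
    refine ⟨fun x hx g => ?_⟩
    have := Subgroup.mem_map_of_mem (MulAut.conj g).toMonoidHom hx
    rw [MonoidHom.map_closure] at this
    refine Subgroup.closure_mono ?_ this
    rintro _ ⟨_, ⟨y, hy, rfl⟩, rfl⟩
    refine ⟨g * y * g⁻¹, Subgroup.Normal.conj_mem inferInstance y hy g, ?_⟩
    simp [conj_pow]
  exact Subgroup.is_normal_topologicalClosure _

/-- The profinite group `Γ` is `p`-projective: every finite embedding problem for `Γ` whose kernel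
is a `p`-group is weakly solvable. A homomorphism to a finite (discrete) group is continuous if
and only if its kernel is open. -/
def IsPProjective (p : ℕ) (Γ : ProfiniteGrp.{0}) : Prop :=
  ∀ (A B : Type) [Group A] [Group B] [Finite A] [Finite B] (π : A →* B) (f : Γ →* B),
    Function.Surjective π → IsPGroup p π.ker → Function.Surjective f →
    IsOpen (f.ker : Set Γ) →
    ∃ f' : Γ →* A, IsOpen (f'.ker : Set Γ) ∧ π.comp f' = f

/-- A universal `p`-Frattini cover of the (finite) group `G`: a profinite group with a continuous
epimorphism onto `G` that is a Frattini cover (no proper closed subgroup maps onto `G`), with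
pro-`p` kernel, and that is `p`-projective. It is unique up to isomorphism over `G`. -/
structure UniversalPFrattiniCover (p : ℕ) (G : Type) [Group G] where
  group : ProfiniteGrp.{0}
  hom : group →* G
  surjective : Function.Surjective hom
  isOpen_ker : IsOpen (hom.ker : Set group)
  ker_pro_p : ∀ (U : Subgroup group) [U.Normal], IsOpen (U : Set group) →
    IsPGroup p (hom.ker.map (QuotientGroup.mk' U))
  frattini : ∀ K : Subgroup group, IsClosed (K : Set group) → K.map hom = ⊤ → K = ⊤
  pProjective : IsPProjective p group

namespace UniversalPFrattiniCover

variable {p : ℕ} {G : Type} [Group G] (U : UniversalPFrattiniCover p G)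

theorem frattiniPro_le : frattiniPro p U.hom.ker ≤ U.hom.ker := by
  refine Subgroup.topologicalClosure_minimal _ (sup_le ?_ (Subgroup.commutator_le_self _))
    (U.hom.ker.isClosed_of_isOpen U.isOpen_ker)
  rw [Subgroup.closure_le]
  rintro _ ⟨x, hx, rfl⟩
  exact pow_mem hx p

/-- The first characteristic quotient `G₁ = G̃ / ker₁`, where `ker₁` is the Frattini subgroup of
`ker₀ = ker (G̃ → G)`. -/
abbrev G₁ : Type := U.group ⧸ frattiniPro p U.hom.ker

/-- The natural map `G₁ → G`. -/
def φ₁ : U.G₁ →* G := QuotientGroup.lift _ U.hom fun _ hx => U.frattiniPro_le hx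

theorem isElemAbCover : IsElemAbCover p U.φ₁ where
  surjective := QuotientGroup.lift_surjective_of_surjective _ _ U.surjective _
  comm x hx y hy := by
    induction x using QuotientGroup.induction_on with | H x =>
    induction y using QuotientGroup.induction_on with | H y =>
    have h : x⁻¹ * y⁻¹ * x⁻¹⁻¹ * y⁻¹⁻¹ ∈ frattiniPro p U.hom.ker := Subgroup.le_topologicalClosure _
      (le_sup_right (a := Subgroup.closure _) (Subgroup.commutator_mem_commutator
        (inv_mem (show x ∈ U.hom.ker from hx)) (inv_mem (show y ∈ U.hom.ker from hy))))
    rw [← QuotientGroup.mk_mul, ← QuotientGroup.mk_mul, eq_comm, QuotientGroup.eq]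
    simpa [commutatorElement_def, mul_assoc] using h
  pow_eq_one x hx := by
    induction x using QuotientGroup.induction_on with | H x =>
    rw [← QuotientGroup.mk_pow, QuotientGroup.eq_one_iff]
    exact Subgroup.le_topologicalClosure _ (le_sup_left (b := ⁅U.hom.ker, U.hom.ker⁆)
      (Subgroup.subset_closure ⟨x, hx, rfl⟩))

/-- The first characteristic `p`-Frattini module `M₀ = ker₀ / ker₁ = ker (G₁ → G)`, an
`𝔽_p[G]`-module. -/
def M₀ : Rep.{0} (ZMod p) G := U.isElemAbCover.kerRep

/-- The natural extension `1 → M₀ → G₁ → G → 1`. -/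
def extension : GroupExtension (Multiplicative U.M₀) U.G₁ G := U.isElemAbCover.extension

variable {H : Subgroup G} (U' : UniversalPFrattiniCover p H)

/-- A homomorphism `γ : G₁' → G₁` that lies over the inclusion `H → G` restricts to an
`𝔽_p[H]`-homomorphism `M₀' → M₀`. -/
def restrictM₀ (γ : U'.G₁ →* U.G₁) (hγ : ∀ x, U.φ₁ (γ x) = (U'.φ₁ x : G)) :
    U'.M₀ ⟶ Rep.res H.subtype U.M₀ :=
  have hmem (x : U'.M₀) : γ (U'.extension.inl (Multiplicative.ofAdd x)) ∈ U.φ₁.ker := by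
    have h : U'.φ₁ (U'.extension.inl (Multiplicative.ofAdd x)) = 1 := U'.isElemAbCover.incl_mem _
    rw [MonoidHom.mem_ker, hγ, h, Subgroup.coe_one]
  Rep.ofHom (ρ := U'.M₀.ρ) (σ := (Rep.res H.subtype U.M₀).ρ)
    { AddMonoidHom.toZModLinearMap p
        (AddMonoidHom.mk' (fun x : U'.M₀ => (U.isElemAbCover.ofKer _ (hmem x) : U.M₀))
          fun x y => U.isElemAbCover.incl_ofAdd_injective <|
            (congrArg γ (map_mul U'.extension.inl _ _)).trans (map_mul γ _ _)) with
      isIntertwining' := fun h => by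
        obtain ⟨e, rfl⟩ := U'.isElemAbCover.surjective h
        refine LinearMap.ext fun x => U.isElemAbCover.incl_ofAdd_injective ?_
        change γ (U'.isElemAbCover.incl (Multiplicative.ofAdd (U'.M₀.ρ (U'.φ₁ e) x))) =
          U.isElemAbCover.incl (Multiplicative.ofAdd (U.isElemAbCover.kerRep.ρ (U'.φ₁ e : G) _))
        rw [← hγ]
        refine (congrArg γ (U'.isElemAbCover.incl_smul e x)).trans
          (Eq.trans ?_ (U.isElemAbCover.incl_smul (γ e) _).symm)
        rw [map_mul, map_mul, map_inv]
        rfl }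

/-- The map `restrictM₀` is the restriction of `γ`. -/
theorem extension_inl_restrictM₀ (γ : U'.G₁ →* U.G₁) (hγ : ∀ x, U.φ₁ (γ x) = (U'.φ₁ x : G))
    (x : U'.M₀) :
    U.extension.inl (Multiplicative.ofAdd ((U.restrictM₀ U' γ hγ).hom x)) =
      γ (U'.extension.inl (Multiplicative.ofAdd x)) := rfl

/-- The `𝔽_p[G]`-homomorphism `Ind_H^G M₀' → M₀` that extends the restriction of `γ` to `M₀'`. -/
def indMap (γ : U'.G₁ →* U.G₁) (hγ : ∀ x, U.φ₁ (γ x) = (U'.φ₁ x : G)) :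
    Rep.ind H.subtype U'.M₀ ⟶ U.M₀ :=
  (Rep.indResHomEquiv.{0} H.subtype U'.M₀ U.M₀).symm (U.restrictM₀ U' γ hγ)

end UniversalPFrattiniCover

end Frattini

end PFrattini

end

noncomputable section

namespace PFrattini

/-! ### The first characteristic quotient of a universal `p`-Frattini cover -/

/-! Write `G`, `H` for $G_0$, $G_0'$, and `n` for the index of `H`. The group `G₁` is finite and has
two properties. Every finite extension of `G` by an elementary abelian `p`-group receives a map from
`G₁` over `G` (`exists_lift`). No proper subgroup of `G₁` maps onto `G` (`eq_top_of_map_φ₁`), so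
every endomorphism of `G₁` over `G` is bijective.

Comparison of $G^*$ with `G₁`: the restriction of the induced class to `H`, projected to `M₀'`, is
`α'`. The projection of modules therefore extends to a homomorphism from the preimage of `H` in
$G^*$ to `G₁'` (`HasClass.exists_hom`), and `γ` carries it on to `G₁`. As `n` is prime to `p`,
averaging over the cosets of `H` turns this partial lift into `Θ : G* → G₁` over `G`
(`exists_average_lift`). On the kernel the average is a trace, equal to `n⁻¹ ψ`; this is the scalar
in the theorem. Universality gives `F : G₁ → G*`, and `Θ ∘ F` is bijective, so `ψ` is a split
epimorphism. Also `ker Θ = ker ψ`.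

Indecomposability of `M₀`: the module is compared with the kernel of the boundary `k[G × G] → k[G]`
of the standard resolution of `k = 𝔽_p`. A derivation `β` of `G₁` into `k[G × G]` embeds `M₀` in
this kernel as a direct summand (`exists_linearMap_of_derivation`). Dimension shifting shows that
each endomorphism of `M₀` is a scalar plus the restriction of a derivation `G₁ → M₀`
(`exists_derivation_eq_sub_smul`). The Frattini property forbids a nonzero idempotent to extend to a
derivation with values in its image (`eq_zero_of_derivation`), so every idempotent is `0` or `1`.
Divisibility of the order of `G` by `p` makes `M₀` nonzero. -/

theorem IsElemAbCover.isPGroup_ker {p : ℕ} {E G : Type} [Group E] [Group G] {f : E →* G}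
    (h : IsElemAbCover p f) : IsPGroup p f.ker := fun x =>
  ⟨1, Subtype.ext (by simpa using h.pow_eq_one x.1 x.2)⟩

/-- A finitely generated group which is an extension of a finite group by an elementary abelian
group is finite. -/
theorem IsElemAbCover.finite_of_fg {p : ℕ} [Fact p.Prime] {E G : Type} [Group E] [Group G]
    [Finite G] {f : E →* G} (h : IsElemAbCover p f) [Group.FG E] : Finite E := by
  have : f.ker.FiniteIndex := inferInstance
  have hfg : Group.FG f.ker := Subgroup.fg_of_index_ne_zero _
  let _ : CommGroup f.ker := { (inferInstance : Group f.ker) with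
    mul_comm := fun x y => Subtype.ext (h.comm _ x.2 _ y.2) }
  have : Finite f.ker := CommGroup.finite_of_fg_isMulTorsion _ fun x => by
    rw [isOfFinOrder_iff_pow_eq_one]
    exact ⟨p, (Fact.out : p.Prime).pos, Subtype.ext (h.pow_eq_one _ x.2)⟩
  have : Finite (E ⧸ f.ker) := inferInstance
  exact Finite.of_equiv _ (Subgroup.groupEquivQuotientProdSubgroup (s := f.ker)).symm

namespace UniversalPFrattiniCover

variable {p : ℕ} {G : Type} [Group G] (U : UniversalPFrattiniCover p G)

theorem isClosed_frattiniPro : IsClosed (frattiniPro p U.hom.ker : Set U.group) :=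
  Subgroup.isClosed_topologicalClosure _

theorem eq_top_of_isClosed_comap {L : Subgroup U.G₁} (hL : L.map U.φ₁ = ⊤)
    (hc : IsClosed (L.comap (QuotientGroup.mk' (frattiniPro p U.hom.ker)) : Set U.group)) :
    L = ⊤ := by
  have h := U.frattini _ hc ?_
  · rw [← Subgroup.map_comap_eq_self_of_surjective
      (QuotientGroup.mk'_surjective (frattiniPro p U.hom.ker)) L, h]
    exact Subgroup.map_top_of_surjective _ (QuotientGroup.mk'_surjective _)
  · rw [eq_top_iff, ← hL]
    rintro _ ⟨x, hx, rfl⟩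
    induction x using QuotientGroup.induction_on with | H x =>
    exact ⟨x, hx, rfl⟩

theorem isClosed_comap_of_finite (L : Subgroup U.G₁) [Finite L] :
    IsClosed (L.comap (QuotientGroup.mk' (frattiniPro p U.hom.ker)) : Set U.group) := by
  have := U.isClosed_frattiniPro
  have : IsClosed (L : Set U.G₁) := (Set.toFinite (L : Set U.G₁)).isClosed
  exact this.preimage QuotientGroup.continuous_mk

/-- One lift of each element of `G` generates a finitely generated subgroup `D` that maps onto `G`,
hence a finite one. Since `ker₁` is closed, finite subsets of `G₁` are closed, so the Frattini
property applies to `D` and gives `D = G₁`. -/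
instance finite_G₁ [Fact p.Prime] [Finite G] : Finite U.G₁ := by
  let D : Subgroup U.G₁ :=
    Subgroup.closure (Set.range (Function.surjInv U.isElemAbCover.surjective))
  have hD : D.map U.φ₁ = ⊤ := by
    rw [eq_top_iff]
    intro g _
    exact ⟨_, Subgroup.subset_closure ⟨g, rfl⟩, Function.surjInv_eq _ _⟩
  have : Group.FG D := Group.closure_finite_fg _
  have hcov : IsElemAbCover p (U.φ₁.comp D.subtype) :=
    { surjective := fun g => by
        obtain ⟨x, hx, rfl⟩ : g ∈ D.map U.φ₁ := hD ▸ Subgroup.mem_top g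
        exact ⟨⟨x, hx⟩, rfl⟩
      comm := fun x hx y hy => Subtype.ext (U.isElemAbCover.comm _ hx _ hy)
      pow_eq_one := fun x hx => Subtype.ext (U.isElemAbCover.pow_eq_one _ hx) }
  have : Finite D := hcov.finite_of_fg
  have hT : D = ⊤ := U.eq_top_of_isClosed_comap hD (U.isClosed_comap_of_finite D)
  exact Set.finite_univ_iff.1 (by
    rw [← Subgroup.coe_top, ← hT]; exact Set.toFinite (D : Set U.G₁))

/-- `G₁ → G` is a Frattini cover. -/
theorem eq_top_of_map_φ₁ [Fact p.Prime] [Finite G] {L : Subgroup U.G₁} (hL : L.map U.φ₁ = ⊤) :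
    L = ⊤ :=
  U.eq_top_of_isClosed_comap hL (U.isClosed_comap_of_finite L)

theorem surjective_of_comp_φ₁ [Fact p.Prime] [Finite G] {X : Type} [Group X] (f : X →* U.G₁)
    (hf : Function.Surjective (U.φ₁.comp f)) : Function.Surjective f := by
  rw [← MonoidHom.range_eq_top]
  refine U.eq_top_of_map_φ₁ ?_
  rw [← MonoidHom.range_comp, MonoidHom.range_eq_top]
  exact hf

/-- An endomorphism of `G₁` over `G` is bijective. -/
theorem bijective_of_comp_φ₁ [Fact p.Prime] [Finite G] (f : U.G₁ →* U.G₁)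
    (hf : ∀ x, U.φ₁ (f x) = U.φ₁ x) : Function.Bijective f := by
  refine Function.Surjective.bijective_of_finite (U.surjective_of_comp_φ₁ f ?_)
  have : U.φ₁.comp f = U.φ₁ := MonoidHom.ext hf
  rw [this]
  exact U.isElemAbCover.surjective

/-- `G₁` is universal among the finite extensions of `G` by elementary abelian `p`-groups. -/
theorem exists_lift [Finite G] {B : Type} [Group B] [Finite B] {π : B →* G}
    (hπ : IsElemAbCover p π) : ∃ f : U.G₁ →* B, ∀ x, π (f x) = U.φ₁ x := by
  obtain ⟨f, hf, hf'⟩ := U.pProjective B G π U.hom hπ.surjective hπ.isPGroup_ker U.surjective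
    U.isOpen_ker
  have hmem : ∀ x ∈ U.hom.ker, f x ∈ π.ker := fun x hx => by
    rw [MonoidHom.mem_ker, ← MonoidHom.comp_apply, hf']
    exact hx
  -- The image of `ker₀` is elementary abelian, so `f` kills `p`-th powers and commutators; its
  -- kernel is open, hence closed, so it contains `ker₁`.
  have hle : frattiniPro p U.hom.ker ≤ f.ker := by
    refine Subgroup.topologicalClosure_minimal _ (sup_le ?_ ?_) (f.ker.isClosed_of_isOpen hf)
    · rw [Subgroup.closure_le]
      rintro _ ⟨x, hx, rfl⟩
      change f (x ^ p) = 1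
      rw [map_pow]
      exact hπ.pow_eq_one _ (hmem x hx)
    · rw [Subgroup.commutator_le]
      intro x hx y hy
      rw [MonoidHom.mem_ker, map_commutatorElement, commutatorElement_eq_one_iff_mul_comm]
      exact hπ.comm _ (hmem x hx) _ (hmem y hy)
  refine ⟨QuotientGroup.lift _ f hle, fun x => ?_⟩
  induction x using QuotientGroup.induction_on with | H x =>
  exact DFunLike.congr_fun hf' x

end UniversalPFrattiniCover

/-! ### Lifts over a subgroup of index prime to `p` -/

namespace IsElemAbCover

variable {p : ℕ} {E G : Type} [Group E] [Group G] {φ : E →* G} (h : IsElemAbCover p φ)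

/-- The inclusion of the module `h.kerRep` in `E`. -/
def ι (a : h.kerRep) : E := h.incl (Multiplicative.ofAdd a)

theorem ι_add (a b : h.kerRep) : h.ι (a + b) = h.ι a * h.ι b := rfl

theorem ι_zero : h.ι 0 = 1 := rfl

theorem hom_ι (a : h.kerRep) : φ (h.ι a) = 1 := h.incl_mem _

theorem ι_injective : Function.Injective h.ι := fun _ _ => h.incl_ofAdd_injective

theorem ι_ρ (e : E) (a : h.kerRep) : h.ι (h.kerRep.ρ (φ e) a) = e * h.ι a * e⁻¹ :=
  h.incl_smul e a

theorem mul_ι (e : E) (a : h.kerRep) : e * h.ι a = h.ι (h.kerRep.ρ (φ e) a) * e := by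
  rw [ι_ρ]; group

theorem exists_eq_ι {e : E} (he : φ e = 1) : ∃ a, e = h.ι a := ⟨h.ofKer e he, rfl⟩

theorem exists_eq_ι_mul {x y : E} (hxy : φ x = φ y) : ∃ a, x = h.ι a * y := by
  obtain ⟨a, ha⟩ := h.exists_eq_ι (e := x * y⁻¹) (by simp [hxy])
  exact ⟨a, by rw [← ha]; group⟩

/-- Let `f : Q → G` be surjective, and let `H` be a subgroup of `G` of index prime to `p`. The
average of the conjugates of a lift of `f` to `E` over `H` is a lift of `f` to `E` over `G`. -/
theorem exists_average_lift [Fact p.Prime] [Finite G] {Q : Type} [Group Q] {f : Q →* G}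
    (hf : Function.Surjective f) (H : Subgroup G) (hH : ¬ p ∣ H.index)
    (θ : H.comap f →* E) (hθ : ∀ x, φ (θ x) = f x) :
    ∃ Θ : Q →* E, (∀ x, φ (Θ x) = f x) ∧
      ∀ (m : Q) (w : G → h.kerRep),
        (∀ x : Q, ∃ hx : x * m * x⁻¹ ∈ H.comap f, θ ⟨x * m * x⁻¹, hx⟩ = h.ι (w (f x))) →
        Θ m = h.ι ((H.index : ZMod p)⁻¹ •
          ∑ᶠ q : G ⧸ H, h.kerRep.ρ q.out (w q.out⁻¹)) := by
  classical
  have : Fintype (G ⧸ H) := Fintype.ofFinite _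
  simp only [finsum_eq_sum_of_fintype]
  have hn : (H.index : ZMod p) ≠ 0 := by rwa [Ne, ZMod.natCast_eq_zero_iff]
  have hcard : ∀ v : h.kerRep, (H.index : ZMod p)⁻¹ • ∑ _q : G ⧸ H, v = v := fun v => by
    rw [Finset.sum_const, Finset.card_univ, ← Nat.card_eq_fintype_card, ← Subgroup.index,
      ← Nat.cast_smul_eq_nsmul (ZMod p), smul_smul, inv_mul_cancel₀ hn, one_smul]
  obtain ⟨r, hr, -⟩ := exists_retraction (H.comap f)
  let s : Q → E := fun x => Function.surjInv h.surjective (f x)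
  have hs : ∀ x, φ (s x) = f x := fun x => Function.surjInv_eq _ _
  -- A set-theoretic lift of `f` that is left equivariant under the preimage of `H` through `θ`.
  let σ : Q → E := fun x => θ (r x) * s ((r x : Q)⁻¹ * x)
  have hσ : ∀ x, φ (σ x) = f x := fun x => by
    simp only [σ, map_mul, hθ, hs, map_inv, mul_inv_cancel_left]
  have hσθ : ∀ (y : H.comap f) (x : Q), σ (y * x) = θ y * σ x := fun y x => by
    simp only [σ, hr, map_mul, Subgroup.coe_mul, mul_inv_rev, mul_assoc, inv_mul_cancel_left]
  let ℓ : G ⧸ H → Q := fun q => Function.surjInv hf q.out⁻¹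
  have hℓ : ∀ q, f (ℓ q) = q.out⁻¹ := fun q => Function.surjInv_eq _ _
  -- One lift of `f` for each coset, with `ℓ q` over `q.out⁻¹`. Each is multiplicative up to a
  -- translation of cosets, which disappears on averaging.
  let τ : G ⧸ H → Q → E := fun q g => (σ (ℓ q))⁻¹ * σ (ℓ q * g)
  have hφτ : ∀ q g, φ (τ q g) = f g := fun q g => by simp [τ, hσ]
  have hτ : ∀ q g g', τ q (g * g') = τ q g * τ ((f g)⁻¹ • q) g' := by
    intro q g g'
    have hmem : ℓ q * g * (ℓ ((f g)⁻¹ • q))⁻¹ ∈ H.comap f := by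
      rw [Subgroup.mem_comap, map_mul, map_mul, map_inv, hℓ, hℓ, inv_inv]
      have h1 : (((f g)⁻¹ • q).out : G ⧸ H) = (((f g)⁻¹ * q.out : G) : G ⧸ H) := by
        rw [QuotientGroup.out_eq', ← smul_eq_mul, ← MulAction.Quotient.smul_coe,
          QuotientGroup.out_eq']
      have h2 := QuotientGroup.eq.1 h1.symm
      simpa [mul_assoc] using h2
    obtain ⟨y, e1⟩ : ∃ y : H.comap f, ℓ q * g = y * ℓ ((f g)⁻¹ • q) := ⟨⟨_, hmem⟩, by simp⟩
    have e2 : ℓ q * (g * g') = y * (ℓ ((f g)⁻¹ • q) * g') := by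
      rw [← mul_assoc, ← mul_assoc, ← e1]
    change (σ (ℓ q))⁻¹ * σ (ℓ q * (g * g')) = (σ (ℓ q))⁻¹ * σ (ℓ q * g) * _
    rw [e2, e1, hσθ, hσθ]
    simp only [τ]
    group
  choose v hv using fun q g => h.exists_eq_ι_mul ((hφτ q g).trans (hs g).symm)
  choose c hc using fun g g' => h.exists_eq_ι_mul
    (show φ (s g * s g') = φ (s (g * g')) by simp only [map_mul, hs])
  have hvmul : ∀ q g g', v q (g * g') =
      v q g + h.kerRep.ρ (f g) (v ((f g)⁻¹ • q) g') + c g g' := by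
    intro q g g'
    apply h.ι_injective
    have h1 := hτ q g g'
    rw [hv, hv, hv, mul_assoc (h.ι (v q g)), ← mul_assoc (s g), h.mul_ι, hs, mul_assoc _ (s g),
      hc, ← mul_assoc, ← mul_assoc] at h1
    rw [mul_right_cancel h1, ι_add, ι_add]
  -- The average of the differences `v q` between `τ q` and `s`. The factor set `c` of `s` does not
  -- depend on `q`, so it survives the average unchanged and `ι w · s` is a homomorphism.
  let w : Q → h.kerRep := fun g => (H.index : ZMod p)⁻¹ • ∑ q, v q g
  have hw : ∀ g g', w (g * g') = w g + h.kerRep.ρ (f g) (w g') + c g g' := by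
    intro g g'
    simp only [w, hvmul, Finset.sum_add_distrib, smul_add, hcard, map_smul, map_sum]
    congr 3
    exact Fintype.sum_equiv (MulAction.toPerm (f g)⁻¹) _ _ fun _ => rfl
  refine ⟨MonoidHom.mk' (fun g => h.ι (w g) * s g) fun g g' => ?_, fun g => ?_, fun m u hu => ?_⟩
  · rw [hw, mul_assoc (h.ι (w g)), ← mul_assoc (s g), h.mul_ι, hs, mul_assoc _ (s g),
      hc, ← mul_assoc, ← mul_assoc, ι_add, ι_add]
  · change φ (h.ι (w g) * s g) = f g
    rw [map_mul, h.hom_ι, one_mul, hs]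
  · change h.ι (w m) * s m = _
    have hτu : ∀ q, τ q m = h.ι (h.kerRep.ρ q.out (u q.out⁻¹)) := by
      intro q
      obtain ⟨hx, hx'⟩ := hu (ℓ q)
      have e1 : ℓ q * m = (⟨_, hx⟩ : H.comap f) * ℓ q := by simp
      simp only [τ]
      rw [e1, hσθ, hx', hℓ, ← mul_assoc]
      have := h.ι_ρ (σ (ℓ q))⁻¹ (u q.out⁻¹)
      rw [map_inv, hσ, hℓ, inv_inv, inv_inv] at this
      exact this.symm
    have hm : φ (s m) = 1 := by
      rw [hs, ← hφτ (QuotientGroup.mk 1) m, hτu, h.hom_ι]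
    -- The lift `s` need not be normalized, so `s m` may be nontrivial; its contribution `b` cancels
    -- at the end.
    obtain ⟨b, hb⟩ := h.exists_eq_ι hm
    have hvb : ∀ q, v q m = h.kerRep.ρ q.out (u q.out⁻¹) - b := by
      intro q
      rw [eq_sub_iff_add_eq]
      apply h.ι_injective
      rw [ι_add, ← hb, ← hv, hτu]
    rw [hb, ← ι_add]
    simp only [w, hvb, Finset.sum_sub_distrib, smul_sub, hcard, sub_add_cancel]

end IsElemAbCover

/-! ### Homomorphisms between extensions -/

section ExtensionHom

open groupCohomology

variable {k G E : Type} [CommRing k] [Group G] [Group E]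

theorem HasClass.mul_inl {A : Rep.{0} k G} {S : GroupExtension (Multiplicative A) E G} {c : H2 A}
    (hS : HasClass S c) (e : E) (a : A) :
    e * S.inl (Multiplicative.ofAdd a) =
      S.inl (Multiplicative.ofAdd (A.ρ (S.rightHom e) a)) * e := by
  rw [hS.conj]; group

/-- Let `f` be a map of coefficients from a representation `A` of `G` to a representation `B` of a
subgroup `H`. If `f` sends the class of an extension `S` to the class of an extension `S'`, then
`f` extends to a homomorphism from the preimage of `H` in `S` to `S'`. -/
theorem HasClass.exists_hom {A : Rep.{0} k G} {S : GroupExtension (Multiplicative A) E G}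
    {c : H2 A} (hS : HasClass S c) {H : Subgroup G} {B : Rep.{0} k H} {E' : Type} [Group E']
    {S' : GroupExtension (Multiplicative B) E' H} {c' : H2 B} (hS' : HasClass S' c')
    (f : Rep.res H.subtype A ⟶ B) (hf : groupCohomology.map H.subtype f 2 c = c') :
    ∃ π : H.comap S.rightHom →* E', (∀ x, (S'.rightHom (π x) : G) = S.rightHom x) ∧
      ∀ (a : A) (ha : S.inl (Multiplicative.ofAdd a) ∈ H.comap S.rightHom),
        π ⟨_, ha⟩ = S'.inl (Multiplicative.ofAdd (f.hom a)) := by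
  obtain ⟨σ, x, hσ, rfl⟩ := hS.exists_factorSet
  obtain ⟨σ', x', hσ', rfl⟩ := hS'.exists_factorSet
  have h1 : H2π B (mapCocycles₂ H.subtype f x) = H2π B x' :=
    (H2π_comp_map_apply H.subtype f x).symm.trans hf
  rw [H2π_eq_iff] at h1
  -- The factor sets differ by the coboundary of `b`. The homomorphism sought sends `v · σ g` to `(f
  -- v + b g) · σ' g`.
  obtain ⟨b, hb⟩ := h1
  have hb' : ∀ g h : H, f.hom (x (g.1, h.1)) =
      x' (g, h) + (B.ρ g (b h) - b (g * h) + b g) := fun g h => by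
    have := congrFun hb (g, h)
    exact eq_add_of_sub_eq' this.symm
  have hex : ∀ y : E, ∃ v : A, y = S.inl (Multiplicative.ofAdd v) * σ (S.rightHom y) := by
    intro y
    have : y * (σ (S.rightHom y))⁻¹ ∈ S.inl.range := by
      rw [S.range_inl_eq_ker_rightHom, MonoidHom.mem_ker, map_mul, map_inv,
        GroupExtension.Section.rightHom_section, mul_inv_cancel]
    obtain ⟨v, hv⟩ := this
    exact ⟨v.toAdd, by rw [ofAdd_toAdd, hv]; group⟩
  have hinj : ∀ {a b : A}, S.inl (Multiplicative.ofAdd a) = S.inl (Multiplicative.ofAdd b) →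
    a = b := fun h => Multiplicative.ofAdd.injective (S.inl_injective h)
  choose v hv using hex
  have hvmul : ∀ y z, v (y * z) = v y + A.ρ (S.rightHom y) (v z) +
      x (S.rightHom y, S.rightHom z) := by
    intro y z
    apply hinj
    apply mul_right_cancel (b := σ (S.rightHom (y * z)))
    rw [← hv]
    conv_lhs => rw [hv y, hv z]
    rw [mul_assoc, ← mul_assoc (σ _), hS.mul_inl, GroupExtension.Section.rightHom_section,
      mul_assoc _ (σ _), hσ,
      map_mul S.rightHom y z, ofAdd_add, ofAdd_add, map_mul S.inl, map_mul S.inl]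
    simp only [mul_assoc]
  let r : H.comap S.rightHom → H := fun y => ⟨S.rightHom y, y.2⟩
  have hr : ∀ y z, r (y * z) = r y * r z := fun y z => Subtype.ext (map_mul S.rightHom _ _)
  have hfv : ∀ y z : H.comap S.rightHom, f.hom (v (y * z)) + b (r (y * z)) =
      (f.hom (v y) + b (r y)) + B.ρ (r y) (f.hom (v z) + b (r z)) + x' (r y, r z) := by
    intro y z
    rw [hvmul, map_add, map_add, map_add]
    have e1 : f.hom (A.ρ (S.rightHom y) (v z)) = B.ρ (r y) (f.hom (v z)) :=
      Rep.hom_comm_apply f (r y) (v z)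
    have e2 := hb' (r y) (r z)
    rw [e1, hr]
    refine (congrArg (fun t => f.hom (v y) + B.ρ (r y) (f.hom (v z)) + t + b (r y * r z))
      e2).trans ?_
    abel
  refine ⟨MonoidHom.mk' (fun y => S'.inl (Multiplicative.ofAdd (f.hom (v y) + b (r y))) * σ' (r y))
    fun y z => ?_, fun y => ?_, fun a ha => ?_⟩
  · rw [Subgroup.coe_mul, hfv, mul_assoc _ (σ' _), ← mul_assoc (σ' _), hS'.mul_inl,
      GroupExtension.Section.rightHom_section,
      mul_assoc _ (σ' _), hσ', ofAdd_add, ofAdd_add, map_mul, map_mul, hr]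
    simp only [mul_assoc]
  · change ((S'.rightHom (S'.inl _ * σ' (r y)) : H) : G) = _
    rw [map_mul, S'.rightHom_inl, GroupExtension.Section.rightHom_section, one_mul]
  · change S'.inl (Multiplicative.ofAdd (f.hom (v (S.inl (Multiplicative.ofAdd a))) +
      b (r ⟨_, ha⟩))) * σ' (r ⟨_, ha⟩) = _
    have hr1 : r ⟨_, ha⟩ = 1 := Subtype.ext (S.rightHom_inl _)
    -- The sections are not normalized; the values `x (1, 1)`, `x' (1, 1)` and `b 1` compensate one
    -- another.
    have hσ1 : σ 1 = S.inl (Multiplicative.ofAdd (x (1, 1))) := by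
      have := hσ 1 1
      rw [mul_one] at this
      exact mul_right_cancel this
    have hσ1' : σ' 1 = S'.inl (Multiplicative.ofAdd (x' (1, 1))) := by
      have := hσ' 1 1
      rw [mul_one] at this
      exact mul_right_cancel this
    have hva : a = v (S.inl (Multiplicative.ofAdd a)) + x (1, 1) := by
      apply hinj
      rw [ofAdd_add, map_mul, ← hσ1]
      conv_lhs => rw [hv (S.inl _), S.rightHom_inl]
    rw [hr1, hσ1', ← map_mul, ← ofAdd_add]
    have h2 : f.hom (x (1, 1)) = x' (1, 1) + b 1 := by
      have := hb' 1 1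
      simpa using this
    conv_rhs => rw [hva, map_add]
    refine congrArg (fun t => S'.inl (Multiplicative.ofAdd t)) ?_
    refine Eq.trans ?_ (congrArg (fun t => f.hom (v (S.inl (Multiplicative.ofAdd a))) + t) h2.symm)
    abel

end ExtensionHom

/-! ### Induced modules -/

section Induced

variable {k G : Type} [CommRing k] [Group G] (H : Subgroup G) [H.FiniteIndex] (A : Rep.{0} k H)

theorem indProj_mk (g : G) (a : A) :
    (indProj H A).hom (Representation.IndV.mk H.subtype A.ρ g a) =
      open scoped Classical in Rep.indToCoindAux A g a 1 := by
  classical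
  change ((Rep.indCoindIso A).hom.hom (Representation.IndV.mk H.subtype A.ρ g a)).1 1 = _
  change (Rep.indToCoind A (Representation.IndV.mk H.subtype A.ρ g a)).1 1 = _
  simp
  rfl

theorem indProj_mk_of_mem (h : H) (a : A) :
    (indProj H A).hom (Representation.IndV.mk H.subtype A.ρ (h : G) a) = A.ρ h⁻¹ a := by
  classical
  rw [indProj_mk]
  have := Rep.indToCoindAux_mul_fst (1 : G) 1 (A.ρ h⁻¹ a) h
  rw [← Module.End.mul_apply, ← map_mul, mul_inv_cancel, map_one, Module.End.one_apply,
    mul_one, Rep.indToCoindAux_self] at this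
  exact this

theorem indProj_mk_of_notMem (g : G) (hg : g ∉ H) (a : A) :
    (indProj H A).hom (Representation.IndV.mk H.subtype A.ρ g a) = 0 := by
  classical
  rw [indProj_mk, Rep.indToCoindAux_of_not_rel]
  rintro ⟨s, hs⟩
  apply hg
  rw [← inv_inv g, ← eq_inv_of_mul_eq_one_left (show (s : G) * g = 1 from hs)]
  exact inv_mem s.2

/-- The map `Ind_H^G A → B` attached to an `H`-map `f : A → B` is the trace of the composition of
`f` with the projection `Ind_H^G A → A`. -/
theorem indResHomEquiv_symm_apply_eq_sum (B : Rep.{0} k G) (f : A ⟶ Rep.res H.subtype B)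
    (x : Rep.ind H.subtype A) :
    ((Rep.indResHomEquiv.{0} H.subtype A B).symm f).hom x =
      ∑ᶠ q : G ⧸ H, B.ρ q.out (f.hom ((indProj H A).hom
        ((Rep.ind H.subtype A).ρ q.out⁻¹ x))) := by
  classical
  have : Fintype (G ⧸ H) := Fintype.ofFinite _
  rw [finsum_eq_sum_of_fintype]
  let R : (Rep.ind H.subtype A) →ₗ[k] B := ∑ q : G ⧸ H, B.ρ q.out ∘ₗ f.hom.toLinearMap ∘ₗ
    (indProj H A).hom.toLinearMap ∘ₗ (Rep.ind H.subtype A).ρ q.out⁻¹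
  have hR : ∀ x, R x = ∑ q : G ⧸ H, B.ρ q.out (f.hom ((indProj H A).hom
        ((Rep.ind H.subtype A).ρ q.out⁻¹ x))) := fun x => by
    simp only [R, LinearMap.sum_apply]
    rfl
  rw [← hR]
  refine LinearMap.congr_fun (f := ((Rep.indResHomEquiv.{0} H.subtype A B).symm f).hom.toLinearMap)
    (g := R) (Representation.IndV.hom_ext _ _ fun g => LinearMap.ext fun a => ?_) x
  have hmk : ∀ q : G ⧸ H, (Rep.ind H.subtype A).ρ q.out⁻¹
      (Representation.IndV.mk H.subtype A.ρ g a) =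
        Representation.IndV.mk H.subtype A.ρ (g * q.out) a := fun q => by
    simp
  refine Eq.trans ?_ (hR _).symm
  -- The projection of `mk (g * q.out) a` vanishes unless `g * q.out` lies in `H`, that is, unless
  -- `q` is the coset of `g⁻¹`.
  rw [Finset.sum_eq_single ((g⁻¹ : G) : G ⧸ H)]
  · obtain ⟨h, hh⟩ := QuotientGroup.mk_out_eq_mul H g⁻¹
    rw [hmk, hh, mul_inv_cancel_left, indProj_mk_of_mem, map_mul, Module.End.mul_apply]
    have e := Rep.hom_comm_apply f h (A.ρ h⁻¹ a)
    rw [← Module.End.mul_apply, ← map_mul, mul_inv_cancel, map_one, Module.End.one_apply] at e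
    refine Eq.trans ?_ (congrArg (B.ρ g⁻¹) e)
    simp
  · intro q _ hq
    rw [hmk, indProj_mk_of_notMem, map_zero, map_zero]
    intro hm
    apply hq
    rw [← QuotientGroup.out_eq' q, eq_comm, QuotientGroup.eq, inv_inv]
    exact hm
  · intro hq
    exact absurd (Finset.mem_univ _) hq

end Induced

/-! ### Derivations -/

section Derivation

variable {k E G : Type} [CommRing k] [Group E] [Group G]

/-- `β` is a derivation (a crossed homomorphism) from `E` to the `G`-module `B`, on which `E` acts
through `φ : E → G`. -/
def IsDerivation (φ : E →* G) (B : Rep.{0} k G) (β : E → B) : Prop :=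
  ∀ x y, β (x * y) = β x + B.ρ (φ x) (β y)

namespace IsDerivation

variable {φ : E →* G} {B C : Rep.{0} k G} {β β' : E → B}

theorem map_one (hβ : IsDerivation φ B β) : β 1 = 0 := by
  simpa using hβ 1 1

theorem sub (hβ : IsDerivation φ B β) (hβ' : IsDerivation φ B β') :
    IsDerivation φ B (fun x => β x - β' x) := fun x y => by
  simp only [hβ x y, hβ' x y, map_sub]
  abel

theorem smul (hβ : IsDerivation φ B β) (c : k) : IsDerivation φ B (fun x => c • β x) :=
  fun x y => by simp only [hβ x y, smul_add, map_smul]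

theorem comp (hβ : IsDerivation φ B β) (f : B ⟶ C) :
    IsDerivation φ C (fun x => f.hom (β x)) := fun x y => by
  simp only [hβ x y, map_add, Rep.hom_comm_apply]

theorem inner (φ : E →* G) (b : B) : IsDerivation φ B (fun x => B.ρ (φ x) b - b) := fun x y => by
  simp only [map_mul, Module.End.mul_apply, map_sub]
  abel

/-- The subgroup on which a derivation vanishes. -/
def zeroSubgroup (hβ : IsDerivation φ B β) : Subgroup E where
  carrier := {x | β x = 0}
  one_mem' := hβ.map_one
  mul_mem' {x y} hx hy := by
    change β (x * y) = 0
    rw [hβ, show β x = 0 from hx, show β y = 0 from hy, map_zero, add_zero]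
  inv_mem' {x} hx := by
    have h := hβ x⁻¹ x
    rw [inv_mul_cancel, hβ.map_one, show β x = 0 from hx, map_zero, add_zero] at h
    exact h.symm

theorem mem_zeroSubgroup (hβ : IsDerivation φ B β) (x : E) :
    x ∈ hβ.zeroSubgroup ↔ β x = 0 := Iff.rfl

end IsDerivation

end Derivation

/-! ### Derivations on an elementary abelian cover -/

section KerDerivation

variable {p : ℕ} {E G : Type} [Group E] [Group G] {φ : E →* G} (h : IsElemAbCover p φ)
  {B : Rep.{0} (ZMod p) G} {β : E → B}

/-- The restriction of a derivation to the kernel is a homomorphism of `G`-modules. -/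
def IsDerivation.restrictKer (hβ : IsDerivation φ B β) : h.kerRep ⟶ B :=
  Rep.ofHom (ρ := h.kerRep.ρ) (σ := B.ρ)
    { AddMonoidHom.toZModLinearMap p
        (AddMonoidHom.mk' (fun a : h.kerRep => β (h.ι a)) fun a b => by
          rw [h.ι_add, hβ, h.hom_ι, _root_.map_one, Module.End.one_apply]) with
      isIntertwining' := fun g => by
        obtain ⟨e, rfl⟩ := h.surjective g
        refine LinearMap.ext fun a => ?_
        change β (h.ι (h.kerRep.ρ (φ e) a)) = B.ρ (φ e) (β (h.ι a))
        have h1 := congrArg β (h.mul_ι e a)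
        rw [hβ, hβ, h.hom_ι, _root_.map_one, Module.End.one_apply, add_comm] at h1
        exact (add_right_cancel h1).symm }

theorem IsDerivation.restrictKer_apply (hβ : IsDerivation φ B β) (a : h.kerRep) :
    (hβ.restrictKer h).hom a = β (h.ι a) := rfl

theorem IsDerivation.ι_mul (hβ : IsDerivation φ B β) (a : h.kerRep) (x : E) :
    β (h.ι a * x) = β (h.ι a) + β x := by
  rw [hβ, h.hom_ι, _root_.map_one, Module.End.one_apply]

theorem IsElemAbCover.finite_kerRep [Finite E] : Finite h.kerRep :=
  Finite.of_injective _ h.ι_injective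

end KerDerivation

/-! ### Modules of functions on a free `G`-set -/

section FunRep

variable {k G : Type} [CommRing k] [Group G] (X : Type) [MulAction G X]

variable (k G) in
/-- The module of functions `X → k` on a `G`-set `X`. -/
def funRep : Rep.{0} k G := Rep.of (X := X → k)
  { toFun := fun g => LinearMap.funLeft k k (fun x => g⁻¹ • x)
    map_one' := by ext; simp [LinearMap.funLeft]
    map_mul' := fun g g' => by
      refine LinearMap.ext fun f => funext fun x => ?_
      change f ((g * g')⁻¹ • x) = f (g'⁻¹ • g⁻¹ • x)
      rw [mul_inv_rev, mul_smul] }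

/-- The value of an element of `funRep k G X`. -/
def funRep.eval (f : funRep k G X) (x : X) : k := (show X → k from f) x

/-- The element of `funRep k G X` given by a function. -/
def funRep.mk (f : X → k) : funRep k G X := f

variable {X}

theorem funRep.ext {f f' : funRep k G X} (h : ∀ x, funRep.eval X f x = funRep.eval X f' x) :
    f = f' := funext h

theorem funRep.eval_mk (f : X → k) (x : X) : funRep.eval (G := G) X (funRep.mk X f) x = f x := rfl

theorem funRep.eval_ρ (g : G) (f : funRep k G X) (x : X) :
    funRep.eval X ((funRep k G X).ρ g f) x = funRep.eval X f (g⁻¹ • x) := rfl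

theorem funRep.eval_add (f f' : funRep k G X) (x : X) :
    funRep.eval X (f + f') x = funRep.eval X f x + funRep.eval X f' x := rfl

theorem funRep.eval_sub (f f' : funRep k G X) (x : X) :
    funRep.eval X (f - f') x = funRep.eval X f x - funRep.eval X f' x := rfl

theorem funRep.eval_smul (c : k) (f : funRep k G X) (x : X) :
    funRep.eval X (c • f) x = c * funRep.eval X f x := rfl

theorem funRep.eval_zero (x : X) : funRep.eval X (0 : funRep k G X) x = 0 := rfl

variable (k G) in
/-- The function on `G` with value `1` at `1` and `0` elsewhere. -/
def deltaOne : funRep k G G :=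
  open scoped Classical in funRep.mk G fun y => if y = 1 then 1 else 0

theorem eval_ρ_deltaOne (g y : G) [Decidable (y = g)] :
    funRep.eval G ((funRep k G G).ρ g (deltaOne k G)) y = if y = g then 1 else 0 := by
  classical
  rw [funRep.eval_ρ, deltaOne, funRep.eval_mk, smul_eq_mul]
  exact if_congr (inv_mul_eq_one.trans eq_comm) rfl rfl

end FunRep

section FreeFunRep

variable {p : ℕ} {E G X : Type} [Group E] [Group G] [MulAction G X] {φ : E →* G}
  (h : IsElemAbCover p φ)

/-- A homomorphism from the kernel of `E → G` to the functions on a free `G`-set extends to a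
derivation. -/
theorem IsElemAbCover.exists_derivation_funRep (π : X → G)
    (hπ : ∀ (g : G) x, π (g • x) = g * π x) (F : h.kerRep ⟶ funRep (ZMod p) G X) :
    ∃ D : E → funRep (ZMod p) G X, IsDerivation φ _ D ∧ ∀ a, D (h.ι a) = F.hom a := by
  let s : G → E := Function.surjInv h.surjective
  have hs : ∀ g, φ (s g) = g := fun g => Function.surjInv_eq _ _
  -- The equivariant map `π` to `G` makes the function module coinduced from the trivial group. The
  -- Schreier-type cocycle `m` gives Shapiro's correspondence explicitly: evaluate at `x` after
  -- translating it to the fibre of `π` over `1`.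
  choose m hm using fun (u : G) (e : E) => h.exists_eq_ι
    (show φ (s u⁻¹ * e * (s (u⁻¹ * φ e))⁻¹) = 1 by simp [hs])
  have hadd : ∀ u e e', m u (e * e') = m u e + m ((φ e)⁻¹ * u) e' := by
    intro u e e'
    apply h.ι_injective
    rw [h.ι_add, ← hm, ← hm, ← hm]
    simp only [map_mul, mul_inv_rev, inv_inv]
    group
  refine ⟨fun e => funRep.mk X fun x => funRep.eval X (F.hom (m (π x) e)) ((π x)⁻¹ • x),
    fun e e' => funRep.ext fun x => ?_, fun a => funRep.ext fun x => ?_⟩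
  · simp only [funRep.eval_mk, funRep.eval_add, funRep.eval_ρ, hadd, map_add, hπ]
    simp [mul_smul]
  · rw [funRep.eval_mk]
    have : m (π x) (h.ι a) = h.kerRep.ρ (π x)⁻¹ a := by
      apply h.ι_injective
      rw [← hm, h.hom_ι, mul_one, ← h.ι_ρ, hs]
    rw [this, Rep.hom_comm_apply, funRep.eval_ρ]
    simp

/-- A derivation to the functions on a free `G`-set which vanishes on the kernel of `E → G` is
inner. -/
theorem IsElemAbCover.eq_inner_of_funRep (π : X → G) (hπ : ∀ (g : G) x, π (g • x) = g * π x)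
    {β : E → funRep (ZMod p) G X}
    (hβ : IsDerivation φ _ β) (h0 : ∀ a, β (h.ι a) = 0) :
    ∃ y : funRep (ZMod p) G X, ∀ e, β e = (funRep (ZMod p) G X).ρ (φ e) y - y := by
  let s : G → E := Function.surjInv h.surjective
  have hs : ∀ g, φ (s g) = g := fun g => Function.surjInv_eq _ _
  have hcongr : ∀ {e e'}, φ e = φ e' → β e = β e' := fun {e e'} he => by
    obtain ⟨a, rfl⟩ := h.exists_eq_ι_mul he
    rw [hβ.ι_mul h, h0, zero_add]
  -- Since `β` depends only on the image in `G`, this function is `x ↦ -β(π x)(x)`, the contracting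
  -- homotopy of the coinduced module.
  refine ⟨funRep.mk X fun x => funRep.eval X (β (s (π x)⁻¹)) ((π x)⁻¹ • x),
    fun e => funRep.ext fun x => ?_⟩
  have h1 : β (s ((π x)⁻¹ * φ e)) = β (s (π x)⁻¹ * e) := hcongr (by simp [hs])
  rw [funRep.eval_sub, funRep.eval_ρ, funRep.eval_mk, funRep.eval_mk, hπ]
  simp only [mul_inv_rev, inv_inv, mul_smul, smul_inv_smul, h1, hβ (s _) e, hs, funRep.eval_add,
    funRep.eval_ρ]
  simp

end FreeFunRep

/-! ### The standard resolution in degrees zero and one -/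

section Boundary

variable {k G : Type} [CommRing k] [Group G] [Fintype G]

variable (k G) in
/-- The boundary map from functions on `G × G` to functions on `G`. -/
def boundary : funRep k G (G × G) ⟶ funRep k G G :=
  Rep.ofHom (ρ := (funRep k G (G × G)).ρ) (σ := (funRep k G G).ρ)
    { toFun := fun f => funRep.mk G fun y =>
        ∑ x, funRep.eval (G × G) f (x, y) - ∑ x, funRep.eval (G × G) f (y, x)
      map_add' := fun f f' => funRep.ext fun y => by
        simp only [funRep.eval_mk, funRep.eval_add, Finset.sum_add_distrib]
        ring
      map_smul' := fun c f => funRep.ext fun y => by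
        simp only [funRep.eval_mk, funRep.eval_smul, RingHom.id_apply, ← Finset.mul_sum]
        ring
      isIntertwining' := fun g => LinearMap.ext fun f => funRep.ext fun y => by
        change ∑ x, funRep.eval (G × G) f (g⁻¹ * x, g⁻¹ * y) -
          ∑ x, funRep.eval (G × G) f (g⁻¹ * y, g⁻¹ * x) =
          ∑ x, funRep.eval (G × G) f (x, g⁻¹ * y) - ∑ x, funRep.eval (G × G) f (g⁻¹ * y, x)
        congr 1 <;> exact Fintype.sum_equiv (Equiv.mulLeft g⁻¹) _ _ fun _ => rfl }

theorem eval_boundary (f : funRep k G (G × G)) (y : G) :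
    funRep.eval G ((boundary k G).hom f) y =
      ∑ x, funRep.eval (G × G) f (x, y) - ∑ x, funRep.eval (G × G) f (y, x) := rfl

theorem sum_eval_boundary (f : funRep k G (G × G)) :
    ∑ y, funRep.eval G ((boundary k G).hom f) y = 0 := by
  simp only [eval_boundary, Finset.sum_sub_distrib]
  rw [Finset.sum_comm, sub_self]

/-- Regard pairs as directed edges. Edges from `1` to `y` with weight `t y` have boundary `t`, up to
a multiple of the vertex `1` that is the total weight, here zero. -/
theorem exists_boundary_eq (t : funRep k G G) (ht : ∑ y, funRep.eval G t y = 0) :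
    ∃ z, (boundary k G).hom z = t := by
  classical
  refine ⟨funRep.mk (G × G) fun x => if x.1 = 1 then funRep.eval G t x.2 else 0,
    funRep.ext fun y => ?_⟩
  simp only [eval_boundary, funRep.eval_mk, Finset.sum_ite_eq', Finset.mem_univ, if_true]
  by_cases hy : y = 1 <;> simp [hy, ht]

theorem sum_eval_deltaOne : ∑ y, funRep.eval G (deltaOne k G) y = 1 := by
  classical
  simp only [deltaOne, funRep.eval_mk]
  exact (Finset.sum_ite_eq' _ _ _).trans (if_pos (Finset.mem_univ _))

theorem sum_eval_ρ (g : G) (t : funRep k G G) :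
    ∑ y, funRep.eval G ((funRep k G G).ρ g t) y = ∑ y, funRep.eval G t y :=
  Fintype.sum_equiv (Equiv.mulLeft g⁻¹) _ _ fun _ => rfl

end Boundary

/-! ### Indecomposability of the first characteristic module -/

section SemidirectProduct

variable {k G : Type} [CommRing k] [Group G] (B : Rep.{0} k G)

/-- The action of `G` on the multiplicative group of a `G`-module. -/
def mulAutOfRep : G →* MulAut (Multiplicative B) where
  toFun g := AddEquiv.toMultiplicative
    { toFun := B.ρ g
      invFun := B.ρ g⁻¹
      left_inv := fun b => by simp
      right_inv := fun b => by simp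
      map_add' := map_add _ }
  map_one' := MulEquiv.ext fun b => congrArg Multiplicative.ofAdd (by
    change B.ρ 1 b.toAdd = b.toAdd
    simp)
  map_mul' g g' := MulEquiv.ext fun b => congrArg Multiplicative.ofAdd (by
    change B.ρ (g * g') b.toAdd = B.ρ g (B.ρ g' b.toAdd)
    simp)

variable {B} {C : Rep.{0} k G}

/-- The pairs `(b, g)` in the semidirect product of `B` and `G` with `d b = g c - c`. -/
def fiberSubgroup (d : B ⟶ C) (c : C) : Subgroup (Multiplicative B ⋊[mulAutOfRep B] G) where
  carrier := {y | d.hom y.left.toAdd = C.ρ y.right c - c}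
  one_mem' := by
    change d.hom 0 = C.ρ 1 c - c
    simp
  mul_mem' {x y} hx hy := by
    change d.hom (x.left.toAdd + B.ρ x.right y.left.toAdd) = C.ρ (x.right * y.right) c - c
    rw [map_add, Rep.hom_comm_apply, show d.hom x.left.toAdd = _ from hx,
      show d.hom y.left.toAdd = _ from hy, map_mul, Module.End.mul_apply, map_sub]
    abel
  inv_mem' {x} hx := by
    change d.hom (B.ρ x.right⁻¹ (-x.left.toAdd)) = C.ρ x.right⁻¹ c - c
    rw [Rep.hom_comm_apply, map_neg, show d.hom x.left.toAdd = _ from hx, neg_sub, map_sub]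
    simp

end SemidirectProduct

namespace UniversalPFrattiniCover

variable {p : ℕ} {G : Type} [Group G] (U : UniversalPFrattiniCover p G)

/-- The fiber subgroup is an extension of `G` by the elementary abelian group `ker d`; `hc` gives
surjectivity onto `G`. Universality of `G₁` yields a lift, whose `B`-coordinate is the derivation.
-/
theorem exists_derivation_of_fiber [Finite G] {B C : Rep.{0} (ZMod p) G} [Finite B] (d : B ⟶ C)
    (c : C) (hc : ∀ g, ∃ b, d.hom b = C.ρ g c - c) :
    ∃ β : U.G₁ → B, IsDerivation U.φ₁ B β ∧ ∀ x, d.hom (β x) = C.ρ (U.φ₁ x) c - c := by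
  have : Finite (Multiplicative B ⋊[mulAutOfRep B] G) :=
    Finite.of_equiv (Multiplicative B × G) (SemidirectProduct.equivProd).symm
  let q : fiberSubgroup d c →* G := SemidirectProduct.rightHom.comp (fiberSubgroup d c).subtype
  have hleft : ∀ x y : fiberSubgroup d c, x ∈ q.ker →
      (x.1 * y.1).left = x.1.left * y.1.left := fun x y hx => by
    rw [SemidirectProduct.mul_left, show x.1.right = 1 from hx, map_one]
    rfl
  have hq : IsElemAbCover p q :=
    { surjective := fun g => by
        obtain ⟨b, hb⟩ := hc g
        exact ⟨⟨⟨Multiplicative.ofAdd b, g⟩, hb⟩, rfl⟩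
      comm := fun x hx y hy => by
        refine Subtype.ext (SemidirectProduct.ext ?_ ?_)
        · change (x.1 * y.1).left = (y.1 * x.1).left
          rw [hleft x y hx, hleft y x hy, mul_comm]
        · change x.1.right * y.1.right = y.1.right * x.1.right
          rw [show x.1.right = 1 from hx, show y.1.right = 1 from hy]
      pow_eq_one := fun x hx => by
        have hpow : ∀ n : ℕ, (x ^ n).1.left = x.1.left ^ n := by
          intro n
          induction n with
          | zero => rw [pow_zero, pow_zero]; rfl
          | succ n ih =>
            rw [pow_succ, Subgroup.coe_mul, hleft _ _ (pow_mem hx n), ih, pow_succ]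
        refine Subtype.ext (SemidirectProduct.ext ?_ (pow_mem hx p : _ ∈ q.ker))
        rw [hpow]
        change Multiplicative.ofAdd (p • x.1.left.toAdd) = Multiplicative.ofAdd 0
        rw [← Nat.cast_smul_eq_nsmul (ZMod p), CharP.cast_eq_zero, zero_smul] }
  obtain ⟨F, hF⟩ := U.exists_lift hq
  have hr : ∀ x, (F x).1.right = U.φ₁ x := hF
  refine ⟨fun x => (F x).1.left.toAdd, fun x y => ?_, fun x => ?_⟩
  · change (F (x * y)).1.left.toAdd = _
    rw [map_mul, ← hr]
    rfl
  · rw [← hr]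
    exact (F x).2

variable [Fact p.Prime] [Finite G]

/-- A derivation with values in the kernel of `G₁ → G` which restricts to an idempotent
endomorphism `e` of the kernel is zero if it takes its values in the image of `e`. -/
theorem eq_zero_of_derivation {D : U.G₁ → U.isElemAbCover.kerRep}
    (hD : IsDerivation U.φ₁ U.isElemAbCover.kerRep D)
    (e : U.isElemAbCover.kerRep ⟶ U.isElemAbCover.kerRep)
    (hDe : ∀ a, D (U.isElemAbCover.ι a) = e.hom a)
    (heD : ∀ x, e.hom (D x) = D x) : e = 0 := by
  have htop : hD.zeroSubgroup = ⊤ := by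
    refine U.eq_top_of_map_φ₁ (eq_top_iff.2 fun g _ => ?_)
    obtain ⟨x, rfl⟩ := U.isElemAbCover.surjective g
    -- Correcting `x` by `-D x` changes `D x` by `-e (D x) = -D x`. Thus the zeros of `D` map onto
    -- `G`, and by the Frattini property they are all of `G₁`.
    refine ⟨U.isElemAbCover.ι (-D x : U.isElemAbCover.kerRep) * x, ?_, ?_⟩
    · change D _ = 0
      rw [hD.ι_mul U.isElemAbCover, hDe, map_neg, heD, neg_add_cancel]
    · rw [map_mul, U.isElemAbCover.hom_ι, one_mul]
  refine Rep.hom_ext (Representation.IntertwiningMap.ext (LinearMap.ext fun a => ?_))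
  have : U.isElemAbCover.ι a ∈ hD.zeroSubgroup := htop ▸ Subgroup.mem_top _
  rw [hD.mem_zeroSubgroup, hDe] at this
  exact this

/-- The universal derivation of `G₁` in the functions on `G × G`. -/
theorem exists_derivation_boundary [Fintype G] :
    ∃ β : U.G₁ → funRep (ZMod p) G (G × G), IsDerivation U.φ₁ _ β ∧
      ∀ x, (boundary (ZMod p) G).hom (β x) =
        (funRep (ZMod p) G G).ρ (U.φ₁ x) (deltaOne (ZMod p) G) - deltaOne (ZMod p) G := by
  have : Finite (funRep (ZMod p) G (G × G)) := inferInstanceAs (Finite (G × G → ZMod p))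
  refine U.exists_derivation_of_fiber _ _ fun g => exists_boundary_eq _ ?_
  simp only [funRep.eval_sub, Finset.sum_sub_distrib, sum_eval_ρ, sub_self]

/-- If `M₀ = 0`, then `β` is inner, given by some `z`, and `deltaOne` minus the boundary of `z` is
an invariant function of total sum `1`. An invariant function on `G` is constant, so its sum is a
multiple of the order of `G`, which is `0` in `𝔽_p`. -/
theorem nontrivial_M₀ (hp : p ∣ Nat.card G) : Nontrivial U.isElemAbCover.kerRep := by
  by_contra hn
  rw [not_nontrivial_iff_subsingleton] at hn
  have : Fintype G := Fintype.ofFinite G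
  obtain ⟨β, hβ, hdβ⟩ := U.exists_derivation_boundary
  obtain ⟨z, hz⟩ := U.isElemAbCover.eq_inner_of_funRep (X := G × G) Prod.fst (fun _ _ => rfl) hβ
    fun a => by rw [show a = 0 from hn.elim _ _]; exact hβ.map_one
  let t := deltaOne (ZMod p) G - (boundary (ZMod p) G).hom z
  have ht : ∀ g, (funRep (ZMod p) G G).ρ g t = t := by
    intro g
    obtain ⟨x, rfl⟩ := U.isElemAbCover.surjective g
    have h1 := hdβ x
    rw [hz, map_sub, Rep.hom_comm_apply] at h1
    simp only [t, map_sub]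
    rw [sub_eq_sub_iff_add_eq_add] at h1 ⊢
    rw [← h1, add_comm]
  have ht1 : ∀ y, funRep.eval G t y = funRep.eval G t 1 := fun y => by
    conv_lhs => rw [← ht y, funRep.eval_ρ]
    simp
  have hsum : ∑ y, funRep.eval G t y = 1 := by
    simp only [t, funRep.eval_sub, Finset.sum_sub_distrib, sum_eval_deltaOne, sum_eval_boundary,
      sub_zero]
  simp only [ht1, Finset.sum_const, Finset.card_univ, ← Nat.card_eq_fintype_card,
    nsmul_eq_mul] at hsum
  rw [(ZMod.natCast_eq_zero_iff _ _).2 hp, zero_mul] at hsum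
  exact zero_ne_one hsum

/-- There is a map from the functions on `G × G` to `M₀` which is `G`-linear on the kernel of the
boundary, and whose composition with the universal derivation is bijective on `M₀`. -/
theorem exists_linearMap_of_derivation [Fintype G] {β : U.G₁ → funRep (ZMod p) G (G × G)}
    (hβ : IsDerivation U.φ₁ _ β) (hdβ : ∀ x, (boundary (ZMod p) G).hom (β x) =
        (funRep (ZMod p) G G).ρ (U.φ₁ x) (deltaOne (ZMod p) G) - deltaOne (ZMod p) G) :
    ∃ η : funRep (ZMod p) G (G × G) →ₗ[ZMod p] U.isElemAbCover.kerRep,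
      (∀ g f, (boundary (ZMod p) G).hom f = 0 →
        η ((funRep (ZMod p) G (G × G)).ρ g f) = U.isElemAbCover.kerRep.ρ g (η f)) ∧
      Function.Bijective fun a : U.isElemAbCover.kerRep => η (β (U.isElemAbCover.ι a)) := by
  classical
  set h := U.isElemAbCover
  -- The section is normalized so that `a g 1 = 0` and so that `T` below is exactly `η ∘ β` on the
  -- kernel.
  let s : G → U.G₁ := fun g => if g = 1 then 1 else Function.surjInv h.surjective g
  have hs1 : s 1 = 1 := if_pos rfl
  have hs : ∀ g, U.φ₁ (s g) = g := fun g => by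
    by_cases hg : g = 1
    · simp [s, hg]
    · simp only [s, if_neg hg]
      exact Function.surjInv_eq _ _
  choose a ha using fun g g' => h.exists_eq_ι_mul
    (show U.φ₁ (s g * s g') = U.φ₁ (s (g * g')) by simp only [map_mul, hs])
  have ha1 : ∀ g, a g 1 = 0 := fun g => by
    apply h.ι_injective
    have := ha g 1
    rw [hs1, mul_one, mul_one] at this
    exact (right_eq_mul.1 this).trans h.ι_zero.symm
  have hcoc : ∀ g g' g'', a g g' + a (g * g') g'' = h.kerRep.ρ g (a g' g'') + a g (g' * g'') := by
    intro g g' g''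
    apply h.ι_injective
    apply mul_right_cancel (b := s (g * g' * g''))
    have e1 : s g * s g' * s g'' = s g * (s g' * s g'') := mul_assoc _ _ _
    rw [ha g g', mul_assoc, ha (g * g'), ha g' g'', ← mul_assoc (s g), h.mul_ι, hs,
      mul_assoc _ (s g),
      ha g (g' * g''), ← mul_assoc, ← mul_assoc] at e1
    rw [h.ι_add, h.ι_add, e1, mul_assoc g]
  let η : funRep (ZMod p) G (G × G) →ₗ[ZMod p] h.kerRep :=
    { toFun := fun f => ∑ x : G × G, funRep.eval (G × G) f x • a x.1 (x.1⁻¹ * x.2)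
      map_add' := fun f f' => by
        simp only [funRep.eval_add, add_smul, Finset.sum_add_distrib]
      map_smul' := fun c f => by
        simp only [funRep.eval_smul, mul_smul, Finset.smul_sum, RingHom.id_apply] }
  have hη : ∀ f, η f = ∑ x : G × G, funRep.eval (G × G) f x • a x.1 (x.1⁻¹ * x.2) := fun _ => rfl
  -- By the cocycle identity, `η` fails to be `G`-linear only through the boundary of `f`.
  have hηρ : ∀ g f, η ((funRep (ZMod p) G (G × G)).ρ g f) = h.kerRep.ρ g (η f) +
      ∑ y, funRep.eval G ((boundary (ZMod p) G).hom f) y • a g y := by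
    intro g f
    have e1 : η ((funRep (ZMod p) G (G × G)).ρ g f) =
        ∑ x : G × G, funRep.eval (G × G) f x • a (g * x.1) (x.1⁻¹ * x.2) := by
      rw [hη]
      refine Fintype.sum_equiv (MulAction.toPerm g⁻¹) _ _ fun x => ?_
      rw [funRep.eval_ρ]
      simp [mul_assoc]
    have e2 : ∀ x : G × G, a (g * x.1) (x.1⁻¹ * x.2) =
        h.kerRep.ρ g (a x.1 (x.1⁻¹ * x.2)) + (a g x.2 - a g x.1) := fun x => by
      have := hcoc g x.1 (x.1⁻¹ * x.2)
      rw [mul_inv_cancel_left] at this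
      rw [← add_sub_assoc, ← this]
      abel
    rw [e1]
    simp only [e2, smul_add, Finset.sum_add_distrib, smul_sub, Finset.sum_sub_distrib]
    congr 1
    · rw [hη, map_sum]
      simp only [map_smul]
    · simp only [eval_boundary, sub_smul, Finset.sum_smul, Finset.sum_sub_distrib]
      rw [Fintype.sum_prod_type_right, Fintype.sum_prod_type]
  refine ⟨η, fun g f hf => ?_, ?_⟩
  · rw [hηρ, hf]
    simp [funRep.eval_zero]
  have hT : ∀ x y : U.G₁, η (β (x * y)) = η (β x) + h.kerRep.ρ (U.φ₁ x) (η (β y)) +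
      a (U.φ₁ x) (U.φ₁ y) := by
    intro x y
    rw [hβ, map_add, hηρ, hdβ, add_assoc]
    congr 2
    simp only [funRep.eval_sub, sub_smul, Finset.sum_sub_distrib, eval_ρ_deltaOne, ite_smul,
      one_smul, zero_smul, Finset.sum_ite_eq', Finset.mem_univ, if_true]
    rw [Finset.sum_eq_single 1, ha1, smul_zero, sub_zero]
    · intro y _ hy
      simp [deltaOne, funRep.eval_mk, hy]
    · simp
  -- As the boundary of `β y` is a difference of two delta functions, the defect of `η ∘ β` is the
  -- factor set of `s`. So `T` is an endomorphism over `G`, hence bijective.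
  let T : U.G₁ →* U.G₁ := MonoidHom.mk' (fun x => h.ι (η (β x)) * s (U.φ₁ x)) fun x y => by
    rw [hT, h.ι_add, h.ι_add, mul_assoc _ (s _) (_ * _), ← mul_assoc (s _), h.mul_ι (s _), hs,
      mul_assoc _ (s _), ha, map_mul]
    simp only [mul_assoc]
  have hTb := U.bijective_of_comp_φ₁ T fun x => by
    change U.φ₁ (h.ι _ * s _) = _
    rw [map_mul, h.hom_ι, one_mul, hs]
  have hTι : ∀ b, T (h.ι b) = h.ι (η (β (h.ι b))) := fun b => by
    change h.ι _ * s _ = _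
    rw [h.hom_ι, hs1, mul_one]
  have hfin : Finite h.kerRep := h.finite_kerRep
  have hinj : Function.Injective fun b : h.kerRep => η (β (h.ι b)) := fun b b' hb => by
    apply h.ι_injective
    apply hTb.1
    rw [hTι, hTι]
    exact congrArg h.ι hb
  exact ⟨hinj, Finite.surjective_of_injective hinj⟩

end UniversalPFrattiniCover

/-! ### Endomorphisms of the first characteristic module -/

namespace UniversalPFrattiniCover

variable {p : ℕ} {G : Type} [Group G] (U : UniversalPFrattiniCover p G) [Fact p.Prime] [Finite G]

/-- Up to maps which extend to derivations of `G₁`, every endomorphism of `M₀` is a scalar. -/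
theorem exists_derivation_eq_sub_smul (f : U.isElemAbCover.kerRep ⟶ U.isElemAbCover.kerRep) :
    ∃ (c : ZMod p) (D : U.G₁ → U.isElemAbCover.kerRep),
      IsDerivation U.φ₁ U.isElemAbCover.kerRep D ∧
      ∀ a, D (U.isElemAbCover.ι a) = f.hom a - c • a := by
  have : Fintype G := Fintype.ofFinite G
  obtain ⟨β, hβ, hdβ⟩ := U.exists_derivation_boundary
  obtain ⟨η, hη, hηb⟩ := U.exists_linearMap_of_derivation hβ hdβ
  have hdι : ∀ a : U.isElemAbCover.kerRep,
      (boundary (ZMod p) G).hom (β (U.isElemAbCover.ι a)) = 0 := fun a => by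
    rw [hdβ, U.isElemAbCover.hom_ι, map_one, Module.End.one_apply, sub_self]
  let w : U.isElemAbCover.kerRep →ₗ[ZMod p] U.isElemAbCover.kerRep :=
    η ∘ₗ (hβ.restrictKer U.isElemAbCover).hom.toLinearMap
  have hw : ∀ a, w a = η (β (U.isElemAbCover.ι a)) := fun _ => rfl
  let W : U.isElemAbCover.kerRep ≃ₗ[ZMod p] U.isElemAbCover.kerRep :=
    LinearEquiv.ofBijective w hηb
  have hWρ : ∀ g a, W.symm (U.isElemAbCover.kerRep.ρ g a) =
      U.isElemAbCover.kerRep.ρ g (W.symm a) := fun g a => by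
    obtain ⟨b, rfl⟩ := W.surjective a
    rw [W.symm_apply_apply, LinearEquiv.symm_apply_eq]
    change U.isElemAbCover.kerRep.ρ g (η (β (U.isElemAbCover.ι b))) =
      η ((hβ.restrictKer U.isElemAbCover).hom (U.isElemAbCover.kerRep.ρ g b))
    rw [Rep.hom_comm_apply, IsDerivation.restrictKer_apply, hη _ _ (hdι b)]
  obtain ⟨β', hβ', hβ'f⟩ := U.isElemAbCover.exists_derivation_funRep (X := G × G) Prod.fst
    (fun _ _ => rfl) (f ≫ hβ.restrictKer U.isElemAbCover)
  replace hβ'f : ∀ a, β' (U.isElemAbCover.ι a) = β (U.isElemAbCover.ι (f.hom a)) := hβ'f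
  -- The boundary of `β'` vanishes on `M₀`, so it is inner. The total sum `c` of `y` is the scalar:
  -- then `y - c • deltaOne` is a boundary, and `β' - c β` minus an inner derivation takes values in
  -- the kernel of the boundary, where `η` is `G`-linear.
  obtain ⟨y, hy⟩ := U.isElemAbCover.eq_inner_of_funRep (X := G) id (fun _ _ => rfl)
    (hβ'.comp (boundary (ZMod p) G)) fun a => by rw [hβ'f, hdι]
  let c : ZMod p := ∑ x, funRep.eval G y x
  obtain ⟨z, hz⟩ := exists_boundary_eq (y - c • deltaOne (ZMod p) G) (by
    simp only [funRep.eval_sub, funRep.eval_smul, Finset.sum_sub_distrib, ← Finset.mul_sum,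
      sum_eval_deltaOne, mul_one, c, sub_self])
  have hD := (hβ'.sub (hβ.smul c)).sub (IsDerivation.inner U.φ₁ z)
  have hdD : ∀ x, (boundary (ZMod p) G).hom
      (β' x - c • β x - ((funRep (ZMod p) G (G × G)).ρ (U.φ₁ x) z - z)) = 0 := fun x => by
    simp only [map_sub, map_smul, Rep.hom_comm_apply, hz, hy, hdβ, smul_sub]
    abel
  refine ⟨c, fun x => W.symm (η (β' x - c • β x -
    ((funRep (ZMod p) G (G × G)).ρ (U.φ₁ x) z - z))), fun x x' => ?_, fun a => ?_⟩
  · have := hD x x'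
    beta_reduce at this ⊢
    rw [this, map_add, hη _ _ (hdD x'), map_add, hWρ]
  · beta_reduce
    rw [U.isElemAbCover.hom_ι, map_one, Module.End.one_apply, sub_self, sub_zero, hβ'f, map_sub,
      map_smul,
      ← hw, ← hw, LinearEquiv.symm_apply_eq, map_sub, map_smul]
    rfl

/-- An idempotent endomorphism of `M₀` is trivial. -/
theorem eq_zero_or_eq_id_of_idempotent
    (e : U.isElemAbCover.kerRep ⟶ U.isElemAbCover.kerRep) (he : e ≫ e = e) :
    e = 0 ∨ e = 𝟙 _ := by
  have he' : ∀ a, e.hom (e.hom a) = e.hom a := fun a => by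
    conv_rhs => rw [← he]
    rfl
  obtain ⟨c, D, hD, hDe⟩ := U.exists_derivation_eq_sub_smul e
  by_cases hc : c = 0
  · left
    refine U.eq_zero_of_derivation (hD.comp e) e (fun a => ?_) fun x => he' _
    rw [hDe, hc, zero_smul, sub_zero, he']
  · right
    have hid : ∀ a, (𝟙 _ - e : U.isElemAbCover.kerRep ⟶ _).hom a = a - e.hom a := fun _ => rfl
    have h0 : 𝟙 _ - e = 0 := by
      -- Since `(1 - e)(e - c) = -c (1 - e)`, the factor `-c⁻¹` makes the derivation restrict to the
      -- idempotent `1 - e`.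
      refine U.eq_zero_of_derivation ((hD.comp (𝟙 _ - e)).smul (-c⁻¹)) (𝟙 _ - e)
        (fun a => ?_) fun x => ?_
      · have h1 : (a - e.hom a : U.isElemAbCover.kerRep) = -c⁻¹ • -(c • (a - e.hom a)) := by
          rw [smul_neg, neg_smul, neg_neg, smul_smul, inv_mul_cancel₀ hc, one_smul]
        refine Eq.trans ?_ ((hid a).trans h1).symm
        refine congrArg (fun t => -c⁻¹ • t) ?_
        rw [hid, hDe, map_sub, map_smul, he', smul_sub]
        abel
      · simp only [map_smul, hid, map_sub, he', sub_self, sub_zero, smul_zero]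
    exact (sub_eq_zero.1 h0).symm

theorem indecomposable_M₀ (hp : p ∣ Nat.card G) : Indecomposable U.M₀ := by
  change Indecomposable U.isElemAbCover.kerRep
  refine ⟨fun h0 => ?_, fun Y Z i => ?_⟩
  · obtain ⟨a, b, hab⟩ := U.nontrivial_M₀ hp
    have h1 : ∀ x : U.isElemAbCover.kerRep, x = 0 := fun x =>
      congrArg (fun f : U.isElemAbCover.kerRep ⟶ _ => f.hom x) (h0.eq_of_src (𝟙 _) 0)
    exact hab ((h1 a).trans (h1 b).symm)
  · rcases U.eq_zero_or_eq_id_of_idempotent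
      (i.hom ≫ Limits.biprod.fst ≫ Limits.biprod.inl ≫ i.inv) (by simp) with h | h
    · left
      rw [Limits.IsZero.iff_id_eq_zero]
      have := congrArg (fun f => Limits.biprod.inl ≫ i.inv ≫ f ≫ i.hom ≫ Limits.biprod.fst) h
      simpa using this
    · right
      rw [Limits.IsZero.iff_id_eq_zero]
      have := congrArg (fun f => Limits.biprod.inr ≫ i.inv ≫ f ≫ i.hom ≫ Limits.biprod.snd) h
      simpa using this.symm

end UniversalPFrattiniCover

/-! ### Split epimorphisms of representations -/

section Split

variable {k G : Type} [CommRing k] [Group G] {A B : Rep.{0} k G} {ψ : A ⟶ B} {s : B ⟶ A}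

theorem hom_hom_of_comp_eq_id (hs : s ≫ ψ = 𝟙 B) (b : B) : ψ.hom (s.hom b) = b :=
  congrArg (fun f : B ⟶ B => f.hom b) hs

theorem isCompl_range_ker_of_comp_eq_id (hs : s ≫ ψ = 𝟙 B) :
    IsCompl s.hom.range ψ.hom.ker := by
  have hψs := hom_hom_of_comp_eq_id hs
  constructor
  · rw [disjoint_iff_inf_le]
    rintro _ ⟨⟨b, rfl⟩, hb⟩
    have : b = 0 := (hψs b).symm.trans hb
    rw [this]
    exact map_zero s.hom
  · rw [codisjoint_iff_le_sup]
    intro a _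
    refine Submodule.mem_sup.2 ⟨s.hom (ψ.hom a), ⟨_, rfl⟩, a - s.hom (ψ.hom a), ?_, by abel⟩
    change ψ.hom _ = 0
    rw [map_sub, hψs, sub_self]

theorem nonempty_iso_range_of_comp_eq_id (hs : s ≫ ψ = 𝟙 B) :
    Nonempty (Rep.of s.hom.range.toRepresentation ≅ B) := by
  have hψs := hom_hom_of_comp_eq_id hs
  let f : Rep.of s.hom.range.toRepresentation ⟶ B :=
    Rep.ofHom (ρ := s.hom.range.toRepresentation) (σ := B.ρ)
      { ψ.hom.toLinearMap ∘ₗ s.hom.range.toSubmodule.subtype with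
        isIntertwining' := fun g => LinearMap.ext fun x => Rep.hom_comm_apply ψ g x.1 }
  have hf : ∀ x, f.hom x = ψ.hom x.1 := fun _ => rfl
  have : IsIso f := by
    rw [ConcreteCategory.isIso_iff_bijective]
    constructor
    · rintro ⟨_, b, rfl⟩ ⟨_, b', rfl⟩ h
      have h' : ψ.hom (s.hom b) = ψ.hom (s.hom b') := h
      rw [hψs, hψs] at h'
      rw [h']
    · intro b
      exact ⟨⟨s.hom b, b, rfl⟩, hψs b⟩
  exact ⟨asIso f⟩

/-- The section makes `A` the direct sum of `ker ψ` and `B`; as `B` is nonzero, `ker ψ` is zero. -/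
theorem injective_of_indecomposable (hA : Indecomposable A) (hs : s ≫ ψ = 𝟙 B)
    (hB : ¬ Limits.IsZero B) : Function.Injective ψ.hom := by
  have : IsSplitEpi ψ := ⟨⟨⟨s, hs⟩⟩⟩
  let T : ShortComplex (Rep.{0} k G) := ShortComplex.mk (Limits.kernel.ι ψ) ψ (by simp)
  have hT : T.Exact := ShortComplex.exact_of_f_is_kernel _ (Limits.kernelIsKernel ψ)
  have hTm : Mono T.f := inferInstanceAs (Mono (Limits.kernel.ι ψ))
  have hsp := ShortComplex.Splitting.ofExactOfSection T hT s hs hTm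
  have h0 := (hA.2 _ _ hsp.isoBinaryBiproduct).resolve_right hB
  have hmono : Mono ψ := Preadditive.mono_of_kernel_zero (h0.eq_zero_of_src _)
  have : IsIso ψ := isIso_of_mono_of_isSplitEpi ψ
  exact ((ConcreteCategory.isIso_iff_bijective ψ).1 this).1

end Split

/-! ### Extensions by modules as elementary abelian covers -/

section Extension

variable {p : ℕ} {G Q : Type} [Group G] [Group Q] {A : Rep.{0} (ZMod p) G}
  {S : GroupExtension (Multiplicative A) Q G} {c : groupCohomology.H2 A}

theorem exists_eq_inl_of_rightHom_eq_one (S : GroupExtension (Multiplicative A) Q G) {x : Q}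
    (hx : S.rightHom x = 1) : ∃ a : A, x = S.inl (Multiplicative.ofAdd a) := by
  have : x ∈ S.inl.range := by rwa [S.range_inl_eq_ker_rightHom]
  obtain ⟨a, rfl⟩ := this
  exact ⟨a.toAdd, rfl⟩

theorem inl_ofAdd_injective (S : GroupExtension (Multiplicative A) Q G) :
    Function.Injective fun a : A => S.inl (Multiplicative.ofAdd a) :=
  S.inl_injective.comp Multiplicative.ofAdd.injective

theorem isElemAbCover_rightHom (S : GroupExtension (Multiplicative A) Q G) :
    IsElemAbCover p S.rightHom where
  surjective := S.rightHom_surjective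
  comm x hx y hy := by
    obtain ⟨a, rfl⟩ := exists_eq_inl_of_rightHom_eq_one S hx
    obtain ⟨b, rfl⟩ := exists_eq_inl_of_rightHom_eq_one S hy
    rw [← map_mul S.inl, ← map_mul S.inl, mul_comm]
  pow_eq_one x hx := by
    obtain ⟨a, rfl⟩ := exists_eq_inl_of_rightHom_eq_one S hx
    rw [← map_pow, ← ofAdd_nsmul, ← Nat.cast_smul_eq_nsmul (ZMod p), CharP.cast_eq_zero, zero_smul,
      ofAdd_zero, map_one]

theorem finite_of_groupExtension (S : GroupExtension (Multiplicative A) Q G) [Finite A]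
    [Finite G] : Finite Q := by
  refine Finite.of_surjective (fun x : A × G => S.inl (Multiplicative.ofAdd x.1) *
    Function.surjInv S.rightHom_surjective x.2) fun y => ?_
  obtain ⟨a, ha⟩ := exists_eq_inl_of_rightHom_eq_one S
    (x := y * (Function.surjInv S.rightHom_surjective (S.rightHom y))⁻¹) (by
      rw [map_mul, map_inv, Function.surjInv_eq S.rightHom_surjective, mul_inv_cancel])
  exact ⟨(a, S.rightHom y), by simp only [← ha, inv_mul_cancel_right]⟩

/-- A homomorphism of extensions restricts to a homomorphism of modules. -/
theorem HasClass.exists_restrict (hS : HasClass S c) {E : Type} [Group E] {φ : E →* G}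
    (h : IsElemAbCover p φ) (F : E →* Q) (hF : ∀ x, S.rightHom (F x) = φ x) :
    ∃ σ : h.kerRep ⟶ A, ∀ b, S.inl (Multiplicative.ofAdd (σ.hom b)) = F (h.ι b) := by
  choose v hv using fun b : h.kerRep => exists_eq_inl_of_rightHom_eq_one S
    (x := F (h.ι b)) (by rw [hF, h.hom_ι])
  refine ⟨Rep.ofHom (ρ := h.kerRep.ρ) (σ := A.ρ)
    { AddMonoidHom.toZModLinearMap p (AddMonoidHom.mk' v fun b b' => inl_ofAdd_injective S ?_) with
      isIntertwining' := fun g => ?_ }, fun b => (hv b).symm⟩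
  · change S.inl _ = S.inl _
    rw [ofAdd_add, map_mul, ← hv, ← hv, ← hv, h.ι_add, map_mul]
  · obtain ⟨e, rfl⟩ := h.surjective g
    refine LinearMap.ext fun b => inl_ofAdd_injective S ?_
    change S.inl (Multiplicative.ofAdd (v (h.kerRep.ρ (φ e) b))) =
      S.inl (Multiplicative.ofAdd (A.ρ (φ e) (v b)))
    rw [← hF, hS.conj, ← hv, ← hv, hF, h.ι_ρ, map_mul, map_mul, map_inv]

end Extension

theorem finite_ind {p : ℕ} [Fact p.Prime] {G : Type} [Group G] [Finite G] (H : Subgroup G)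
    (A : Rep.{0} (ZMod p) H) [Finite A] : Finite (Rep.ind H.subtype A) := by
  classical
  have : Finite (Rep.coind H.subtype A) :=
    Finite.of_injective (fun f => (f.1 : G → A)) Subtype.val_injective
  exact Finite.of_injective (Rep.indCoindIso A).hom.hom
    ((ConcreteCategory.isIso_iff_bijective (Rep.indCoindIso A).hom).1 inferInstance).1

theorem map_indProj_inducedClass {k G : Type} [CommRing k] [Group G] (H : Subgroup G)
    [H.FiniteIndex] (A : Rep.{0} k H) (a : groupCohomology.H2 A) :
    groupCohomology.map H.subtype (indProj H A) 2 (inducedClass H A a) = a :=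
  Equiv.ofBijective_apply_symm_apply _ (shapiro_bijective H A) a

/-! ### The cover attached to the induced class -/

namespace UniversalPFrattiniCover

theorem ker_eq_subrepSubgroup {p : ℕ} [Fact p.Prime] {G : Type} [Group G]
    (U : UniversalPFrattiniCover p G) {H : Subgroup G} (U' : UniversalPFrattiniCover p H)
    {Q : Type} [Group Q] {S : GroupExtension (Multiplicative (Rep.ind H.subtype U'.M₀)) Q G}
    (γ : U'.G₁ →* U.G₁) (hγ : ∀ x, U.φ₁ (γ x) = (U'.φ₁ x : G))
    (hH : ¬ p ∣ H.index) {Θ : Q →* U.G₁}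
    (hΘ : ∀ x, U.φ₁ (Θ x) = S.rightHom x)
    (hΘa : ∀ a, Θ (S.inl (Multiplicative.ofAdd a)) = U.extension.inl (Multiplicative.ofAdd
        ((H.index : ZMod p)⁻¹ • (U.indMap U' γ hγ).hom a))) :
    Θ.ker = subrepSubgroup S (U.indMap U' γ hγ).hom.ker := by
  have hn : (H.index : ZMod p) ≠ 0 := by rwa [Ne, ZMod.natCast_eq_zero_iff]
  have hiff : ∀ a, Θ (S.inl (Multiplicative.ofAdd a)) = 1 ↔ (U.indMap U' γ hγ).hom a = 0 := by
    intro a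
    rw [hΘa, ← map_one U.extension.inl, U.extension.inl_injective.eq_iff, ← ofAdd_zero,
      Multiplicative.ofAdd.injective.eq_iff, smul_eq_zero_iff_right (inv_ne_zero hn)]
  ext x
  constructor
  · intro hx
    obtain ⟨a, rfl⟩ := exists_eq_inl_of_rightHom_eq_one S (x := x) (by
      rw [← hΘ, show Θ x = 1 from hx, map_one])
    exact ⟨Multiplicative.ofAdd a, (hiff a).1 hx, rfl⟩
  · rintro ⟨a, ha, rfl⟩
    exact (hiff a.toAdd).2 ha

variable {p : ℕ} [Fact p.Prime] {G : Type} [Group G] [Finite G]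
  (U : UniversalPFrattiniCover p G) {H : Subgroup G} (U' : UniversalPFrattiniCover p H)

/-- The preimage of `H` in `G₁` is an elementary abelian cover of `H`, so the universality of `G₁'`
applies. -/
theorem exists_hom_over : ∃ γ : U'.G₁ →* U.G₁, ∀ x, U.φ₁ (γ x) = (U'.φ₁ x : G) := by
  have hcov : IsElemAbCover p (U.φ₁.subgroupComap H) :=
    { surjective := fun g => by
        obtain ⟨x, hx⟩ := U.isElemAbCover.surjective g.1
        exact ⟨⟨x, show U.φ₁ x ∈ H from hx ▸ g.2⟩, Subtype.ext hx⟩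
      comm := fun x hx y hy => Subtype.ext (U.isElemAbCover.comm _ (congrArg Subtype.val hx) _
        (congrArg Subtype.val hy))
      pow_eq_one := fun x hx => Subtype.ext
        (U.isElemAbCover.pow_eq_one _ (congrArg Subtype.val hx)) }
  obtain ⟨f, hf⟩ := U'.exists_lift hcov
  exact ⟨(H.comap U.φ₁).subtype.comp f, fun x => congrArg Subtype.val (hf x)⟩

variable {Q : Type} [Group Q] {S : GroupExtension (Multiplicative (Rep.ind H.subtype U'.M₀)) Q G}

/-- The map `ψ : Ind_H^G M₀' → M₀`, divided by the index of `H`, extends to a homomorphism of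
extensions. -/
theorem exists_hom_extending_indMap
    (hH : ¬ p ∣ H.index) {α' : groupCohomology.H2 U'.M₀} (hα' : HasClass U'.extension α')
    (hS : HasClass S (inducedClass H U'.M₀ α'))
    (γ : U'.G₁ →* U.G₁) (hγ : ∀ x, U.φ₁ (γ x) = (U'.φ₁ x : G)) :
    ∃ Θ : Q →* U.G₁, (∀ x, U.φ₁ (Θ x) = S.rightHom x) ∧
      ∀ a, Θ (S.inl (Multiplicative.ofAdd a)) = U.extension.inl (Multiplicative.ofAdd
        ((H.index : ZMod p)⁻¹ • (U.indMap U' γ hγ).hom a)) := by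
  obtain ⟨π, hπ, hπa⟩ := hS.exists_hom hα' (indProj H U'.M₀) (map_indProj_inducedClass H U'.M₀ α')
  obtain ⟨Θ, hΘ, hΘa⟩ := U.isElemAbCover.exists_average_lift S.rightHom_surjective H hH
    (γ.comp π) fun x => (hγ _).trans (hπ x)
  refine ⟨Θ, hΘ, fun a => ?_⟩
  rw [hΘa (S.inl (Multiplicative.ofAdd a)) fun g => (U.restrictM₀ U' γ hγ).hom
    ((indProj H U'.M₀).hom ((Rep.ind H.subtype U'.M₀).ρ g a))]
  · change U.extension.inl _ = U.extension.inl _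
    rw [indMap, indResHomEquiv_symm_apply_eq_sum]
    rfl
  · intro x
    rw [← hS.conj]
    have hx : S.inl (Multiplicative.ofAdd ((Rep.ind H.subtype U'.M₀).ρ (S.rightHom x) a)) ∈
        H.comap S.rightHom := by
      rw [Subgroup.mem_comap, S.rightHom_inl]
      exact H.one_mem
    exact ⟨hx, congrArg γ (hπa _ hx)⟩

theorem exists_splitting_of_indMap
    (hH : ¬ p ∣ H.index) {α' : groupCohomology.H2 U'.M₀} (hα' : HasClass U'.extension α')
    (hS : HasClass S (inducedClass H U'.M₀ α'))
    (γ : U'.G₁ →* U.G₁) (hγ : ∀ x, U.φ₁ (γ x) = (U'.φ₁ x : G)) :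
    ∃ Θ : Q →* U.G₁, Function.Surjective Θ ∧ (∀ x, U.φ₁ (Θ x) = S.rightHom x) ∧
      (∀ a, Θ (S.inl (Multiplicative.ofAdd a)) = U.extension.inl (Multiplicative.ofAdd
        ((H.index : ZMod p)⁻¹ • (U.indMap U' γ hγ).hom a))) ∧
      ∃ s : U.M₀ ⟶ Rep.ind H.subtype U'.M₀, s ≫ U.indMap U' γ hγ = 𝟙 _ := by
  obtain ⟨Θ, hΘ, hΘa⟩ := U.exists_hom_extending_indMap U' hH hα' hS γ hγ
  refine ⟨Θ, U.surjective_of_comp_φ₁ Θ fun g => ?_, hΘ, hΘa, ?_⟩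
  · obtain ⟨x, rfl⟩ := S.rightHom_surjective g
    exact ⟨x, hΘ x⟩
  have : Finite U'.M₀ := U'.isElemAbCover.finite_kerRep
  have := finite_ind H U'.M₀
  have := finite_of_groupExtension S
  obtain ⟨F, hF⟩ := U.exists_lift (isElemAbCover_rightHom S)
  obtain ⟨σ, hσ⟩ : ∃ σ : U.M₀ ⟶ Rep.ind H.subtype U'.M₀, ∀ b : U.M₀,
      S.inl (Multiplicative.ofAdd (σ.hom b)) = F (U.isElemAbCover.ι b) :=
    hS.exists_restrict U.isElemAbCover F hF
  -- On `M₀` this automorphism of `G₁` is `n⁻¹ • t`, so `t` is injective, hence invertible, and `inv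
  -- t ≫ σ` is a section of `ψ`.
  have hb := U.bijective_of_comp_φ₁ (Θ.comp F) fun x => (hΘ _).trans (hF x)
  let t : U.M₀ ⟶ U.M₀ := σ ≫ U.indMap U' γ hγ
  have ht : ∀ b : U.M₀, Θ (F (U.isElemAbCover.ι b)) =
      U.isElemAbCover.ι ((H.index : ZMod p)⁻¹ • t.hom b : U.M₀) := fun b => by
    rw [← hσ]
    exact hΘa _
  have hinj : Function.Injective t.hom := fun b b' h => by
    apply U.isElemAbCover.ι_injective
    apply hb.1
    refine (ht b).trans (Eq.trans ?_ (ht b').symm)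
    rw [h]
  have hfin : Finite U.M₀ := U.isElemAbCover.finite_kerRep
  have : IsIso t := (ConcreteCategory.isIso_iff_bijective t).2
    ⟨hinj, Finite.surjective_of_injective hinj⟩
  exact ⟨inv t ≫ σ, by rw [Category.assoc]; exact IsIso.inv_hom_id t⟩

end UniversalPFrattiniCover

end PFrattini

end

open CategoryTheory PFrattini groupCohomology in
theorem mainTheorem1 (p : ℕ) [Fact p.Prime] (G₀ : Type) [Group G₀] [Finite G₀]
    (hp : p ∣ Nat.card G₀) (P₀ : Sylow p G₀)
    (U : UniversalPFrattiniCover p G₀)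
    (U' : UniversalPFrattiniCover p (Subgroup.normalizer (P₀ : Set G₀)))
    (α' : H2 U'.M₀) (hα' : HasClass U'.extension α')
    (Gstar : Type) [Group Gstar]
    (S : GroupExtension
      (Multiplicative (Rep.ind (Subgroup.normalizer (P₀ : Set G₀)).subtype U'.M₀)) Gstar G₀)
    (hS : HasClass S (inducedClass _ U'.M₀ α')) :
    -- there are homomorphisms `γ : G₁' → G₁` over the inclusion of `G₀'` in `G₀`
    (∃ γ : U'.G₁ →* U.G₁, ∀ x, U.φ₁ (γ x) = (U'.φ₁ x : G₀)) ∧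
    -- each `γ` gives a surjection `ψ : Ind M₀' → M₀` with a complement `M` of `N = ker ψ`, and
    -- `ψ`, up to a nonzero scalar, induces an isomorphism `G* / N ≅ G₁` of covers of `G₀`
    (∀ (γ : U'.G₁ →* U.G₁) (hγ : ∀ x, U.φ₁ (γ x) = (U'.φ₁ x : G₀)),
      Function.Surjective (U.indMap U' γ hγ).hom ∧
      ∃ M N : Subrepresentation
          (Rep.ind (Subgroup.normalizer (P₀ : Set G₀)).subtype U'.M₀).ρ,
        N = (U.indMap U' γ hγ).hom.ker ∧ IsCompl M N ∧
        Nonempty (Rep.of M.toRepresentation ≅ U.M₀) ∧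
        ∃ (_ : (subrepSubgroup S N).Normal) (e : Gstar ⧸ subrepSubgroup S N ≃* U.G₁)
          (u : (ZMod p)ˣ),
          (∀ x : Gstar, U.φ₁ (e (QuotientGroup.mk x)) = S.rightHom x) ∧
          ∀ a, e (QuotientGroup.mk (S.inl (Multiplicative.ofAdd a))) =
            U.extension.inl (Multiplicative.ofAdd ((u : ZMod p) • (U.indMap U' γ hγ).hom a))) ∧
    Indecomposable U.M₀ ∧
    (Indecomposable (Rep.ind (Subgroup.normalizer (P₀ : Set G₀)).subtype U'.M₀) →
      ∃ e : Gstar ≃* U.G₁, ∀ x, U.φ₁ (e x) = S.rightHom x) := by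
  -- The index is the number of Sylow `p`-subgroups, which is congruent to `1` modulo `p`.
  have hH : ¬ p ∣ (Subgroup.normalizer (P₀ : Set G₀)).index := by
    rw [← Sylow.card_eq_index_normalizer]
    exact not_dvd_card_sylow p G₀
  have hn : ((Subgroup.normalizer (P₀ : Set G₀)).index : ZMod p) ≠ 0 := by
    rwa [Ne, ZMod.natCast_eq_zero_iff]
  obtain ⟨γ₀, hγ₀⟩ := U.exists_hom_over U'
  have hM₀ := U.indecomposable_M₀ hp
  refine ⟨⟨γ₀, hγ₀⟩, fun γ hγ => ?_, hM₀, fun hind => ?_⟩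
  · obtain ⟨Θ, hΘs, hΘ, hΘa, s, hs⟩ := U.exists_splitting_of_indMap U' hH hα' hS γ hγ
    have hker := U.ker_eq_subrepSubgroup U' γ hγ hH hΘ hΘa
    have hnormal : (subrepSubgroup S (U.indMap U' γ hγ).hom.ker).Normal := hker ▸ Θ.normal_ker
    exact ⟨fun b => ⟨_, hom_hom_of_comp_eq_id hs b⟩, s.hom.range, (U.indMap U' γ hγ).hom.ker, rfl,
      isCompl_range_ker_of_comp_eq_id hs, nonempty_iso_range_of_comp_eq_id hs, hnormal,
      (QuotientGroup.quotientMulEquivOfEq hker.symm).trans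
        (QuotientGroup.quotientKerEquivOfSurjective Θ hΘs),
      Units.mk0 _ (inv_ne_zero hn), hΘ, hΘa⟩
  · obtain ⟨Θ, hΘs, hΘ, hΘa, s, hs⟩ := U.exists_splitting_of_indMap U' hH hα' hS γ₀ hγ₀
    have hinj := injective_of_indecomposable hind hs hM₀.1
    have hΘi : Function.Injective Θ := by
      rw [injective_iff_map_eq_one]
      intro x hx
      obtain ⟨a, ha, rfl⟩ : x ∈ subrepSubgroup S (U.indMap U' γ₀ hγ₀).hom.ker :=
        U.ker_eq_subrepSubgroup U' γ₀ hγ₀ hH hΘ hΘa ▸ hx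
      rw [show a = 1 from hinj (Eq.trans ha (map_zero (U.indMap U' γ₀ hγ₀).hom).symm), map_one]
    exact ⟨MulEquiv.ofBijective Θ ⟨hΘi, hΘs⟩, hΘ⟩
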